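/- For $\epsilon>0$ let $\mathrm{sgn}_\epsilon(x)=-1$ if $x\le-\epsilon$, $x/\epsilon$ if $|x|\le\epsilon$, and $1$ if $x\ge\epsilon$. For $\alpha,b>0$ and $(x_1,x_2)\in\mathbb R^2$, the two-agent system $(\alpha,b,(x_1,x_2))$ is $$\dot y_1=\alpha(y_2-y_1)+b(\mathrm{sgn}_\epsilon(y_1)-y_1),\qquad \dot y_2=\alpha(y_1-y_2)+b(\mathrm{sgn}_\epsilon(y_2)-y_2),\qquad t\ge 0,$$ with $(y_1(0),y_2(0))=(x_1,x_2)$; its equilibrium is $\lim_{t\to\infty}(y_1(t),y_2(t))$. Put $X=(2\alpha+b)|x_1-x_2|-2b$, $S=|x_1+x_2|$ and $K=b^{1-2\alpha/b}\alpha^{2\alpha/b}S^{1+2\alpha/b}$. Condition PD: $x_1x_2<0$ and ($X<bS$ or $X>K$). Condition CO: $x_1x_2>0$ or $bS<X<K$. In the stochastic block model with two blocks there are $n$ left and $n$ right agents; each unordered pair of distinct agents is connected, independently, with probability $p(n)\in[0,1]$ if the agents are of the same type and $q(n)\in[0,1]$ otherwise. Let $\boldsymbol A_n$ be the set of all adjacency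 matrices, with the resulting law $\mathbb P$ and expectation $\mathbb E$. Given the realized network, let $N(i)$ be the set of connections of agent $i$; the opinions solve, for $t\ge0$, $$\dot x_{i,n}(t)=\frac{a}{|N(i)|}\sum_{j\in N(i)}(x_{j,n}(t)-x_{i,n}(t))+b(\mathrm{sgn}_\epsilon(x_{i,n}(t))-x_{i,n}(t))$$ (the first term is $0$ if $N(i)=\emptyset$), with $x_{i,n}(0)=x_L$ for every left agent $i$ and $x_{j,n}(0)=x_R$ for every right agent $j$. A function $f(n)$ is $\omega(g(n))$ if for every $c>0$ there is $n_0\ge1$ with $f(n)>c\,g(n)$ for all $n\ge n_0$. Theorem. Let $a,b,\beta>0$ and $x_L,x_R\in\mathbb R$ be such that the two-agent system $(a\beta,b,(x_L,x_R))$ satisfies condition PD or condition CO. Then there are $e_L,e_R\in\mathbb R$ and $\epsilon_0>0$ such that for every $\epsilon\in(0,\epsilon_0)$ the two-agent system $(a\beta,b,(x_L,x_R))$ has equilibrium $(e_L,e_R)$, the opinion dynamics on every network has a solution for all $t\ge0$, and the following holds. Let $p(n)$ and $q(n)$ be $\omega(\ln(n)/n)$ with $\lim_{n\to\infty} q(n)/(q(n)+p(n))=\beta$.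 Then for every $\epsilon'>0$ there exist $\delta>0$, $N>0$, $T>0$ and sets $C_{\delta,n}\subseteq\boldsymbol A_n$ such that $\lim_{n\to\infty}\mathbb P(C_{\delta,n})=1$ and, for all $n\ge N$, $\mathbb P(C_{\delta,n})>0$ and $$|\mathbb E(x_{i,n}(t)\mid C_{\delta,n})-e_L|\le\epsilon'\quad\text{and}\quad|\mathbb E(x_{j,n}(t)\mid C_{\delta,n})-e_R|\le\epsilon'$$ for every left agent $i$, every right agent $j$ and every $t\ge T$. -/

import Mathlib

open MeasureTheory ProbabilityTheory Filter Topology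

namespace OpinionDynamics

/-- The continuous interpolation `sgn_ε` of the sign function. -/
noncomputable def sgnEps (ε x : ℝ) : ℝ :=
  if x ≤ -ε then -1 else if x < ε then x / ε else 1

/-- The velocity of agent `i`'s opinion when the opinions are `x`, the influence of agent `j` on
agent `i` is `w i j`, and the platform has strength `b`. -/
noncomputable def velocity {ι : Type*} [Fintype ι] [DecidableEq ι]
    (w : ι → ι → ℝ) (b ε : ℝ) (x : ι → ℝ) (i : ι) : ℝ :=
  ∑ j ∈ Finset.univ.erase i, w i j * (x j - x i) + b * (sgnEps ε (x i) - x i)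

/-- `x t i` is the opinion of agent `i` at time `t`: the opinions start at `x₀` and solve the
opinion dynamics for all times `t ≥ 0` (with a one-sided derivative at `t = 0`). -/
structure IsTrajectory {ι : Type*} [Fintype ι] [DecidableEq ι]
    (w : ι → ι → ℝ) (b ε : ℝ) (x₀ : ι → ℝ) (x : ℝ → ι → ℝ) : Prop where
  initial : ∀ i, x 0 i = x₀ i
  deriv : ∀ t, 0 ≤ t → ∀ i,
    HasDerivWithinAt (fun s => x s i) (velocity w b ε (x t) i) (Set.Ici 0) t

/-! ### The two-agent system -/

/-- Trajectories of the two-agent system `(a, b, (x₁, x₂))`: the two agents influence each other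
with the same strength `a`. -/
def IsTwoAgentTrajectory (a b ε x₁ x₂ : ℝ) (y : ℝ → Fin 2 → ℝ) : Prop :=
  IsTrajectory (fun _ _ => a) b ε ![x₁, x₂] y

/-- The two-agent system `(a, b, (x₁, x₂))` has a trajectory and it converges to `(e₁, e₂)`. -/
def IsTwoAgentEquilibrium (a b ε x₁ x₂ e₁ e₂ : ℝ) : Prop :=
  (∃ y, IsTwoAgentTrajectory a b ε x₁ x₂ y) ∧
    ∀ y, IsTwoAgentTrajectory a b ε x₁ x₂ y →
      Tendsto (fun t => y t 0) atTop (𝓝 e₁) ∧ Tendsto (fun t => y t 1) atTop (𝓝 e₂)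

/-- Condition PD for `(a, b, (x₁, x₂))`, where `a, b > 0`. -/
def ConditionPD (a b x₁ x₂ : ℝ) : Prop :=
  x₁ * x₂ < 0 ∧
    ((2 * a + b) * |x₁ - x₂| - 2 * b < b * |x₁ + x₂| ∨
      b ^ (1 - 2 * a / b) * a ^ (2 * a / b) * |x₁ + x₂| ^ (1 + 2 * a / b) <
        (2 * a + b) * |x₁ - x₂| - 2 * b)

/-- Condition CO for `(a, b, (x₁, x₂))`, where `a, b > 0`. -/
def ConditionCO (a b x₁ x₂ : ℝ) : Prop :=
  0 < x₁ * x₂ ∨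
    (b * |x₁ + x₂| < (2 * a + b) * |x₁ - x₂| - 2 * b ∧
      (2 * a + b) * |x₁ - x₂| - 2 * b <
        b ^ (1 - 2 * a / b) * a ^ (2 * a / b) * |x₁ + x₂| ^ (1 + 2 * a / b))

/-! ### The stochastic block model with two blocks -/

/-- The `2n` agents: `Sum.inl i` are the left agents, `Sum.inr i` the right agents. -/
abbrev Agent (n : ℕ) : Type := Fin n ⊕ Fin n

/-- The probability of a connection between two agents: `p` for agents of the same type, `q` for
agents of different types. -/
def connectionProb {n : ℕ} (p q : unitInterval) : Sym2 (Agent n) → unitInterval :=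
  Sym2.lift ⟨fun u v => if u.isLeft = v.isLeft then p else q, fun u v => by
    simp only [eq_comm]⟩

/-- The law `ℙ` of the stochastic block model on the finite set of simple graphs (equivalently,
symmetric `0`-`1` adjacency matrices with zero diagonal) on the `2n` agents: independently for
every unordered pair of distinct agents, the pair is connected with probability `connectionProb`
(the coins attached to the pairs `s(u, u)` are discarded by `SimpleGraph.fromEdgeSet`). -/
noncomputable def blockModel (n : ℕ) (p q : unitInterval) : Measure (SimpleGraph (Agent n)) :=
  (Measure.pi fun e : Sym2 (Agent n) =>
      (bernoulliMeasure True False (connectionProb p q e) : Measure Prop)).map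
    fun ω => SimpleGraph.fromEdgeSet {e | ω e}

open Classical in
/-- The normalized influence weights of a graph: `a / dᵢ` if agent `j` is one of the `dᵢ`
connections of agent `i`, and `0` otherwise. -/
noncomputable def influence {n : ℕ} (a : ℝ) (G : SimpleGraph (Agent n)) (i j : Agent n) : ℝ :=
  if G.Adj i j then a / (G.degree i : ℝ) else 0

/-- `x t i` is the opinion of agent `i` at time `t` when the network is `G`, all left agents start
at `xL` and all right agents start at `xR`. -/
def IsBlockTrajectory {n : ℕ} (a b ε xL xR : ℝ) (G : SimpleGraph (Agent n))
    (x : ℝ → Agent n → ℝ) : Prop :=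
  IsTrajectory (influence a G) b ε (Sum.elim (fun _ => xL) (fun _ => xR)) x

/-- The conditional expectation `𝔼(X | C)` of a random variable `X` given an event `C`. -/
noncomputable def condExpectation {Ω : Type*} [MeasurableSpace Ω] (μ : Measure Ω)
    (X : Ω → ℝ) (C : Set Ω) : ℝ :=
  ∫ ω, X ω ∂(ProbabilityTheory.cond μ C)

/-- `f(n)` is `ω(g(n))`. -/
def IsLittleOmega (f g : ℕ → ℝ) : Prop :=
  ∀ c : ℝ, 0 < c → ∃ n₀ : ℕ, 1 ≤ n₀ ∧ ∀ n, n₀ ≤ n → c * g n < f n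

end OpinionDynamics

open OpinionDynamics

/-! The influence weights are nonnegative, so the dynamics is cooperative: strict super- and
subsolutions bound trajectories (`lt_of_velocity_lt`, `lt_of_lt_velocity`, both from
`neg_of_barrier`).

Two agents. While the agents are on opposite sides of `[-ε, ε]` the system is linear. With `u = exp
(-b t)` the sum of the opinions decays like `u` and their difference relaxes like `u ^ (1 + 2α/b)`,
so whether an agent reaches zero is decided by the sign on `[0, 1]` of `φ(u) = 2b + X u ^ (1 + 2α/b)
- (2α + b) S u`. Under PD `φ` is positive, so each agent stays on its side
(`hasRobustEquilibrium_of_split`). In the second case of CO `φ` is negative somewhere, one agent is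
dragged across, and from then on both agree (`hasRobustEquilibrium_of_between`,
`IsTrajectory.tendsto_one`). In all cases the limit does not depend on `ε`, and `sgnEps ε` is
constant near it.

Networks. If every agent has a fraction of cross connections within `δ` of `β`, the two-agent
trajectory, copied to all agents of a type, solves the network dynamics up to a defect of order `δ`.
Grönwall's inequality, with a constant independent of `n`, keeps the opinions close to it up to a
time at which the two-agent system has nearly converged (`exists_balanced_dist_le`). From then on a
small box around the equilibrium traps them (`abs_sub_le_of_balanced`).

Randomness. Chernoff bounds and a union bound over the `2n` agents show that the network is balanced
with probability tending to one (`tendsto_blockModel_balanced`). These networks form the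
conditioning event, on which the estimate is pointwise and so passes to the conditional expectation.
-/

namespace OpinionDynamics

/-! ### The interpolated sign function -/

lemma sgnEps_eq {ε : ℝ} (hε : 0 < ε) (x : ℝ) : sgnEps ε x = max (-1) (min 1 (x / ε)) := by
  unfold sgnEps
  split_ifs with h1 h2
  · have : x / ε ≤ -1 := by rw [div_le_iff₀ hε]; linarith
    rw [min_eq_right (by linarith), max_eq_left this]
  · have h3 : -1 ≤ x / ε := by rw [le_div_iff₀ hε]; linarith
    have h4 : x / ε ≤ 1 := by rw [div_le_iff₀ hε]; linarith
    rw [min_eq_right h4, max_eq_right h3]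
  · have h4 : 1 ≤ x / ε := by rw [le_div_iff₀ hε]; linarith
    rw [min_eq_left h4, max_eq_right (by norm_num)]

lemma sgnEps_neg {ε : ℝ} (hε : 0 < ε) (x : ℝ) : sgnEps ε (-x) = -sgnEps ε x := by
  rw [sgnEps_eq hε, sgnEps_eq hε, neg_div]
  rcases le_total (x / ε) 1 with h | h <;> rcases le_total (-1) (x / ε) with h' | h' <;>
    simp only [min_def, max_def] <;> split_ifs <;> linarith

lemma sgnEps_zero {ε : ℝ} (hε : 0 < ε) : sgnEps ε 0 = 0 := by
  simp [sgnEps_eq hε]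

lemma sgnEps_of_le {ε x : ℝ} (h : x ≤ -ε) : sgnEps ε x = -1 := by simp [sgnEps, h]

lemma sgnEps_of_ge {ε x : ℝ} (hε : 0 < ε) (h : ε ≤ x) : sgnEps ε x = 1 := by
  have h1 : ¬ x ≤ -ε := by linarith
  have h2 : ¬ x < ε := by linarith
  simp [sgnEps, h1, h2]

lemma sgnEps_le_one {ε : ℝ} (hε : 0 < ε) (x : ℝ) : sgnEps ε x ≤ 1 := by
  rw [sgnEps_eq hε]; exact max_le (by norm_num) (min_le_left _ _)

lemma neg_one_le_sgnEps {ε : ℝ} (hε : 0 < ε) (x : ℝ) : -1 ≤ sgnEps ε x := by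
  rw [sgnEps_eq hε]; exact le_max_left _ _

lemma abs_sgnEps_sub_le {ε : ℝ} (hε : 0 < ε) (x y : ℝ) :
    |sgnEps ε x - sgnEps ε y| ≤ ε⁻¹ * |x - y| := by
  rw [sgnEps_eq hε, sgnEps_eq hε]
  refine (abs_max_sub_max_le_max _ _ _ _).trans ?_
  rw [sub_self, abs_zero, max_eq_right (abs_nonneg _)]
  refine (abs_min_sub_min_le_max _ _ _ _).trans ?_
  rw [sub_self, abs_zero, max_eq_right (abs_nonneg _), ← sub_div, abs_div, abs_of_pos hε,
    div_eq_inv_mul]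

/-! ### Barriers -/

/-- A finite family of functions that starts negative stays negative, if the derivative of each
function is negative whenever it is the first one to reach `0`. -/
lemma neg_of_barrier {ι : Type*} [Finite ι] {g g' : ℝ → ι → ℝ} {t₀ t₁ : ℝ}
    (hg : ∀ t ∈ Set.Icc t₀ t₁, ∀ i,
      HasDerivWithinAt (fun s => g s i) (g' t i) (Set.Icc t₀ t₁) t)
    (h0 : ∀ i, g t₀ i < 0)
    (hb : ∀ t ∈ Set.Icc t₀ t₁, ∀ i, (∀ j, g t j ≤ 0) → g t i = 0 → g' t i < 0) :
    ∀ t ∈ Set.Icc t₀ t₁, ∀ i, g t i < 0 := by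
  by_contra! hcon
  obtain ⟨τ, hτ, k, hk⟩ := hcon
  have hcont : ∀ i, ContinuousOn (fun s => g s i) (Set.Icc t₀ t₁) :=
    fun i t ht => (hg t ht i).continuousWithinAt
  set B : Set ℝ := ⋃ i, {t ∈ Set.Icc t₀ t₁ | 0 ≤ g t i} with hB
  have hBc : IsClosed B := by
    refine isClosed_iUnion_of_finite fun i => ?_
    exact (hcont i).preimage_isClosed_of_isClosed isClosed_Icc (isClosed_Ici (a := (0 : ℝ)))
  have hBn : B.Nonempty := ⟨τ, Set.mem_iUnion.2 ⟨k, hτ, hk⟩⟩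
  have hBb : BddBelow B := ⟨t₀, fun t ht => by
    obtain ⟨i, hi⟩ := Set.mem_iUnion.1 ht
    exact hi.1.1⟩
  obtain ⟨i, hs, hi⟩ := Set.mem_iUnion.1 (hBc.csInf_mem hBn hBb)
  set σ := sInf B with hσ
  have hlt : ∀ s ∈ Set.Ico t₀ σ, ∀ j, g s j < 0 := by
    intro s hs' j
    by_contra! hj
    have : s ∈ B := Set.mem_iUnion.2 ⟨j, ⟨hs'.1, hs'.2.le.trans hs.2⟩, hj⟩
    exact absurd (csInf_le hBb this) (not_le.2 hs'.2)
  have hσ0 : t₀ < σ := by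
    rcases hs.1.eq_or_lt with h | h
    · rw [← h] at hi
      exact absurd (h0 i) (not_lt.2 hi)
    · exact h
  have hne : (𝓝[Set.Ico t₀ σ] σ).NeBot := by
    rw [← mem_closure_iff_nhdsWithin_neBot, closure_Ico hσ0.ne]
    exact ⟨hσ0.le, le_rfl⟩
  have hsub : Set.Ico t₀ σ ⊆ Set.Icc t₀ t₁ := fun s h => ⟨h.1, h.2.le.trans hs.2⟩
  have hle : ∀ j, g σ j ≤ 0 := by
    intro j
    have h1 : Tendsto (fun s => g s j) (𝓝[Set.Ico t₀ σ] σ) (𝓝 (g σ j)) :=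
      ((hcont j) σ hs).mono hsub
    refine le_of_tendsto h1 ?_
    filter_upwards [self_mem_nhdsWithin] with s h using (hlt s h j).le
  have hzero : g σ i = 0 := le_antisymm (hle i) hi
  have hd := hb σ hs i hle hzero
  -- At the first hitting time `σ` all slopes of `g · i` from the left are positive, which
  -- contradicts a negative derivative.
  have hslope := hasDerivWithinAt_iff_tendsto_slope.1 ((hg σ hs i).mono hsub)
  have hdiff : Set.Ico t₀ σ \ {σ} = Set.Ico t₀ σ := by
    ext s; simp only [Set.mem_sdiff, Set.mem_Ico, Set.mem_singleton_iff]
    exact ⟨fun h => h.1, fun h => ⟨h, h.2.ne⟩⟩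
  rw [hdiff] at hslope
  obtain ⟨s, hs1, hs2⟩ :=
    ((hslope.eventually (gt_mem_nhds hd)).and self_mem_nhdsWithin).exists
  rw [slope_def_field, hzero] at hs1
  have := hlt s hs2 i
  have h3 : 0 < (g s i - 0) / (s - σ) := div_pos_of_neg_of_neg (by linarith) (by linarith [hs2.2])
  linarith

/-! ### The velocity field -/

section Velocity

variable {ι : Type*} [Fintype ι] [DecidableEq ι] {w : ι → ι → ℝ} {b ε : ℝ}

/-- The velocity field is quasi-monotone. -/
lemma velocity_le_velocity (hw : ∀ i j, 0 ≤ w i j) {x y : ι → ℝ} {i : ι}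
    (hxy : ∀ j, x j ≤ y j) (hi : x i = y i) : velocity w b ε x i ≤ velocity w b ε y i := by
  unfold velocity
  rw [hi]
  gcongr with j _
  · exact hw i j
  · exact hxy j

lemma velocity_neg (hε : 0 < ε) (x : ι → ℝ) (i : ι) :
    velocity w b ε (fun j => -x j) i = -velocity w b ε x i := by
  unfold velocity
  rw [sgnEps_neg hε, neg_add, ← Finset.sum_neg_distrib]
  congr 1
  · exact Finset.sum_congr rfl fun j _ => by ring
  · ring

/-- Agents with equal opinions do not influence each other; hence spatially constant functions serve
as barriers for every weight matrix. -/
lemma velocity_const (c : ℝ) (i : ι) :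
    velocity w b ε (fun _ => c) i = b * (sgnEps ε c - c) := by
  simp [velocity]

/-- A strict supersolution stays above the solution. -/
lemma lt_of_velocity_lt (hw : ∀ i j, 0 ≤ w i j) {x U U' : ℝ → ι → ℝ} {t₀ t₁ : ℝ}
    (hx : ∀ t ∈ Set.Icc t₀ t₁, ∀ i,
      HasDerivWithinAt (fun s => x s i) (velocity w b ε (x t) i) (Set.Icc t₀ t₁) t)
    (hU : ∀ t ∈ Set.Icc t₀ t₁, ∀ i,
      HasDerivWithinAt (fun s => U s i) (U' t i) (Set.Icc t₀ t₁) t)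
    (h0 : ∀ i, x t₀ i < U t₀ i)
    (hlt : ∀ t ∈ Set.Icc t₀ t₁, ∀ i, velocity w b ε (U t) i < U' t i) :
    ∀ t ∈ Set.Icc t₀ t₁, ∀ i, x t i < U t i := by
  intro t ht i
  have := neg_of_barrier (g := fun t i => x t i - U t i)
    (g' := fun t i => velocity w b ε (x t) i - U' t i) (t₀ := t₀) (t₁ := t₁)
    (fun t ht i => (hx t ht i).sub (hU t ht i)) (fun i => by linarith [h0 i])
    (fun t ht i hle h0 => by
      have := velocity_le_velocity (b := b) (ε := ε) hw (x := x t) (y := U t) (i := i)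
        (fun j => by linarith [hle j]) (by linarith)
      linarith [hlt t ht i]) t ht i
  linarith

/-- A strict subsolution stays below the solution. -/
lemma lt_of_lt_velocity (hw : ∀ i j, 0 ≤ w i j) (hε : 0 < ε) {x U U' : ℝ → ι → ℝ} {t₀ t₁ : ℝ}
    (hx : ∀ t ∈ Set.Icc t₀ t₁, ∀ i,
      HasDerivWithinAt (fun s => x s i) (velocity w b ε (x t) i) (Set.Icc t₀ t₁) t)
    (hU : ∀ t ∈ Set.Icc t₀ t₁, ∀ i,
      HasDerivWithinAt (fun s => U s i) (U' t i) (Set.Icc t₀ t₁) t)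
    (h0 : ∀ i, U t₀ i < x t₀ i)
    (hlt : ∀ t ∈ Set.Icc t₀ t₁, ∀ i, U' t i < velocity w b ε (U t) i) :
    ∀ t ∈ Set.Icc t₀ t₁, ∀ i, U t i < x t i := by
  intro t ht i
  have := lt_of_velocity_lt (b := b) (ε := ε) hw (x := fun t i => -x t i) (U := fun t i => -U t i)
    (U' := fun t i => -U' t i) (t₀ := t₀) (t₁ := t₁)
    (fun t ht i => by rw [velocity_neg hε]; exact (hx t ht i).neg)
    (fun t ht i => (hU t ht i).neg) (fun i => by linarith [h0 i])
    (fun t ht i => by rw [velocity_neg hε]; linarith [hlt t ht i]) t ht i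
  linarith

/-- The constant involves the row sums of the weights but not the number of agents, which later
makes the Grönwall estimate uniform in the network. -/
lemma abs_velocity_sub_le (hw : ∀ i j, 0 ≤ w i j) {A : ℝ}
    (hA : ∀ i, ∑ j ∈ Finset.univ.erase i, w i j ≤ A) (hb : 0 ≤ b) (hε : 0 < ε)
    {x y : ι → ℝ} {D : ℝ} (hD : ∀ i, |x i - y i| ≤ D) (i : ι) :
    |velocity w b ε x i - velocity w b ε y i| ≤ (2 * A + b * (ε⁻¹ + 1)) * D := by
  have hD0 : 0 ≤ D := (abs_nonneg _).trans (hD i)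
  have h1 : velocity w b ε x i - velocity w b ε y i =
      ∑ j ∈ Finset.univ.erase i, w i j * ((x j - y j) - (x i - y i)) +
        b * ((sgnEps ε (x i) - sgnEps ε (y i)) - (x i - y i)) := by
    unfold velocity
    rw [add_sub_add_comm, ← Finset.sum_sub_distrib]
    congr 1
    · exact Finset.sum_congr rfl fun j _ => by ring
    · ring
  rw [h1]
  have h2 : |∑ j ∈ Finset.univ.erase i, w i j * ((x j - y j) - (x i - y i))| ≤ A * (2 * D) := by
    refine (Finset.abs_sum_le_sum_abs _ _).trans ?_
    calc _ ≤ ∑ j ∈ Finset.univ.erase i, w i j * (2 * D) := by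
          refine Finset.sum_le_sum fun j _ => ?_
          rw [abs_mul, abs_of_nonneg (hw i j)]
          refine mul_le_mul_of_nonneg_left ?_ (hw i j)
          refine (abs_sub _ _).trans ?_
          linarith [hD i, hD j]
      _ ≤ A * (2 * D) := by
          rw [← Finset.sum_mul]
          exact mul_le_mul_of_nonneg_right (hA i) (by linarith)
  have h3 : |b * ((sgnEps ε (x i) - sgnEps ε (y i)) - (x i - y i))| ≤ b * (ε⁻¹ * D + D) := by
    rw [abs_mul, abs_of_nonneg hb]
    refine mul_le_mul_of_nonneg_left ?_ hb
    refine (abs_sub _ _).trans (add_le_add ((abs_sgnEps_sub_le hε _ _).trans ?_) (hD i))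
    exact mul_le_mul_of_nonneg_left (hD i) (by positivity)
  calc _ ≤ _ := abs_add_le _ _
    _ ≤ _ := add_le_add h2 h3
    _ = _ := by ring

lemma lipschitzWith_velocity (hw : ∀ i j, 0 ≤ w i j) {A : ℝ}
    (hA : ∀ i, ∑ j ∈ Finset.univ.erase i, w i j ≤ A) (hA0 : 0 ≤ A) (hb : 0 ≤ b) (hε : 0 < ε) :
    LipschitzWith (2 * A + b * (ε⁻¹ + 1)).toNNReal (velocity w b ε) := by
  have hK : 0 ≤ 2 * A + b * (ε⁻¹ + 1) := by positivity
  refine LipschitzWith.of_dist_le_mul fun x y => ?_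
  rw [Real.coe_toNNReal _ hK]
  refine (dist_pi_le_iff (by positivity)).2 fun i => ?_
  rw [Real.dist_eq]
  refine abs_velocity_sub_le hw hA hb hε (fun j => ?_) i
  rw [← Real.dist_eq]
  exact dist_le_pi_dist x y j

/-! ### Existence and uniqueness of trajectories -/

/-- Solutions exist on every bounded time interval: the velocity field, cut off outside of a large
box, is bounded and Lipschitz, and its solution does not leave the box. -/
lemma exists_solution_Icc (hw : ∀ i j, 0 ≤ w i j) (hb : 0 < b) (hε : 0 < ε) (x₀ : ι → ℝ)
    {T : ℝ} (hT : 0 ≤ T) :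
    ∃ x : ℝ → ι → ℝ, x 0 = x₀ ∧ ∀ t ∈ Set.Icc 0 T,
      HasDerivWithinAt x (velocity w b ε (x t)) (Set.Icc 0 T) t := by
  set A : ℝ := ∑ i, ∑ j, w i j with hAdef
  have hA0 : 0 ≤ A := Finset.sum_nonneg fun i _ => Finset.sum_nonneg fun j _ => hw i j
  have hA : ∀ i, ∑ j ∈ Finset.univ.erase i, w i j ≤ A := fun i =>
    (Finset.sum_le_sum_of_subset_of_nonneg (Finset.erase_subset _ _) fun j _ _ => hw i j).trans
      (Finset.single_le_sum (f := fun i => ∑ j, w i j)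
        (fun i _ => Finset.sum_nonneg fun j _ => hw i j) (Finset.mem_univ i))
  set K := (2 * A + b * (ε⁻¹ + 1)).toNNReal with hKdef
  have hlip : LipschitzWith K (velocity w b ε) := lipschitzWith_velocity hw hA hA0 hb.le hε
  set R : ℝ := ‖x₀‖ + 2 with hR
  have hRpos : 0 < R := by positivity
  set clip : (ι → ℝ) → ι → ℝ := fun x i => max (-R) (min R (x i)) with hclip
  have hcl : LipschitzWith 1 clip := by
    refine LipschitzWith.of_dist_le_mul fun x y => ?_
    rw [NNReal.coe_one, one_mul]
    refine (dist_pi_le_iff dist_nonneg).2 fun i => ?_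
    refine le_trans ?_ (dist_le_pi_dist x y i)
    rw [Real.dist_eq, Real.dist_eq]
    refine (abs_max_sub_max_le_max _ _ _ _).trans ?_
    rw [sub_self, abs_zero, max_eq_right (abs_nonneg _)]
    refine (abs_min_sub_min_le_max _ _ _ _).trans ?_
    rw [sub_self, abs_zero, max_eq_right (abs_nonneg _)]
  have hclR : ∀ x, ‖clip x‖ ≤ R := fun x => by
    refine (pi_norm_le_iff_of_nonneg hRpos.le).2 fun i => ?_
    rw [Real.norm_eq_abs, abs_le]
    exact ⟨le_max_left _ _, max_le (by linarith) (min_le_left _ _)⟩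
  have hv0 : velocity w b ε 0 = 0 := by
    ext i
    change velocity w b ε (fun _ => 0) i = 0
    rw [velocity_const, sgnEps_zero hε, sub_zero, mul_zero]
  set L : NNReal := K * R.toNNReal with hL
  have hbound : ∀ x, ‖velocity w b ε (clip x)‖ ≤ L := fun x => by
    have h1 := hlip.dist_le_mul (clip x) 0
    rw [hv0, dist_zero_right, dist_zero_right] at h1
    refine h1.trans ?_
    rw [hL, NNReal.coe_mul, Real.coe_toNNReal _ hRpos.le]
    exact mul_le_mul_of_nonneg_left (hclR x) K.2
  have hpl : IsPicardLindelof (fun _ x => velocity w b ε (clip x))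
      (⟨0, le_rfl, hT⟩ : Set.Icc 0 T) x₀ (L * T.toNNReal) 0 L (K * 1) :=
    IsPicardLindelof.of_time_independent (fun x _ => hbound x)
      ((hlip.comp hcl).lipschitzOnWith)
      (by simp [Real.coe_toNNReal _ hT, hT])
  obtain ⟨x, hx0, hx⟩ := hpl.exists_eq_forall_mem_Icc_hasDerivWithinAt₀
  simp only at hx0
  have hxi : ∀ t ∈ Set.Icc 0 T, ∀ i,
      HasDerivWithinAt (fun s => x s i) (velocity w b ε (clip (x t)) i) (Set.Icc 0 T) t :=
    fun t ht => hasDerivWithinAt_pi.1 (hx t ht)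
  -- A barrier level above `1`, where the platform pulls inwards, above the initial data, and below
  -- the cut-off level `R`. Below it the cut-off is inactive.
  set R₀ : ℝ := ‖x₀‖ + 1.5 with hR₀
  have hR01 : 1 < R₀ := by have := norm_nonneg x₀; rw [hR₀]; linarith
  have hR0R : R₀ < R := by rw [hR₀, hR]; linarith
  have hx0le : ∀ i, |x₀ i| < R₀ := fun i => by
    have := norm_le_pi_norm x₀ i
    rw [Real.norm_eq_abs] at this
    rw [hR₀]; linarith
  have hup : ∀ t ∈ Set.Icc 0 T, ∀ i, x t i - R₀ < 0 := by
    refine neg_of_barrier (g' := fun t i => velocity w b ε (clip (x t)) i)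
      (fun t ht i => (hxi t ht i).sub_const _) (fun i => ?_) (fun t ht i hle h0 => ?_)
    · rw [hx0]; linarith [(abs_lt.1 (hx0le i)).2]
    · have := velocity_le_velocity (b := b) (ε := ε) hw (x := clip (x t)) (y := fun _ => R₀)
        (i := i) (fun j => max_le (by linarith) ((min_le_right _ _).trans (by linarith [hle j])))
        (by
          simp only [hclip]
          rw [min_eq_right (by linarith), max_eq_right (by linarith)]; linarith)
      rw [velocity_const] at this
      have h2 := sgnEps_le_one hε R₀
      nlinarith
  have hlow : ∀ t ∈ Set.Icc 0 T, ∀ i, -x t i - R₀ < 0 := by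
    refine neg_of_barrier (g' := fun t i => -velocity w b ε (clip (x t)) i)
      (fun t ht i => (hxi t ht i).neg.sub_const _) (fun i => ?_) (fun t ht i hle h0 => ?_)
    · rw [hx0]; linarith [(abs_lt.1 (hx0le i)).1]
    · have := velocity_le_velocity (b := b) (ε := ε) hw (y := clip (x t)) (x := fun _ => -R₀)
        (i := i) (fun j => le_max_of_le_right (le_min (by linarith) (by linarith [hle j])))
        (by
          simp only [hclip]
          rw [min_eq_right (by linarith), max_eq_right (by linarith)]; linarith)
      rw [velocity_const] at this
      have h2 := neg_one_le_sgnEps hε (-R₀)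
      nlinarith
  refine ⟨x, hx0, fun t ht => ?_⟩
  have hcx : clip (x t) = x t := by
    ext i
    simp only [hclip]
    rw [min_eq_right (by linarith [hup t ht i]), max_eq_right (by linarith [hlow t ht i])]
  have := hx t ht
  rwa [hcx] at this

/-- Every initial value problem has a solution for all times `t ≥ 0`. -/
theorem exists_isTrajectory (hw : ∀ i j, 0 ≤ w i j) (hb : 0 < b) (hε : 0 < ε) (x₀ : ι → ℝ) :
    ∃ x, IsTrajectory w b ε x₀ x := by
  have hex : ∀ T : ℝ, ∃ x : ℝ → ι → ℝ, x 0 = x₀ ∧ (0 ≤ T → ∀ t ∈ Set.Icc 0 T,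
      HasDerivWithinAt x (velocity w b ε (x t)) (Set.Icc 0 T) t) := fun T => by
    by_cases hT : 0 ≤ T
    · obtain ⟨x, h1, h2⟩ := exists_solution_Icc hw hb hε x₀ hT
      exact ⟨x, h1, fun _ => h2⟩
    · exact ⟨fun _ => x₀, rfl, fun h => absurd h hT⟩
  choose X hX0 hX using hex
  obtain ⟨K, hK⟩ : ∃ K, LipschitzWith K (velocity w b ε) :=
    ⟨_, lipschitzWith_velocity (A := ∑ i, ∑ j, w i j) hw (fun i =>
      (Finset.sum_le_sum_of_subset_of_nonneg (Finset.erase_subset _ _) fun j _ _ => hw i j).trans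
      (Finset.single_le_sum (f := fun i => ∑ j, w i j)
        (fun i _ => Finset.sum_nonneg fun j _ => hw i j) (Finset.mem_univ i)))
      (Finset.sum_nonneg fun i _ => Finset.sum_nonneg fun j _ => hw i j) hb.le hε⟩
  have hright : ∀ {T S : ℝ}, 0 ≤ S → S ≤ T → ∀ t ∈ Set.Ico 0 S,
      HasDerivWithinAt (X T) (velocity w b ε (X T t)) (Set.Ici t) t := by
    intro T S hS hST t ht
    refine (hX T (hS.trans hST) t ⟨ht.1, ht.2.le.trans hST⟩).mono_of_mem_nhdsWithin ?_
    filter_upwards [inter_mem_nhdsWithin (Set.Ici t) (Iio_mem_nhds (ht.2.trans_le hST))] with s hs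
    exact ⟨ht.1.trans hs.1, le_of_lt hs.2⟩
  have hcont : ∀ {T S : ℝ}, 0 ≤ S → S ≤ T → ContinuousOn (X T) (Set.Icc 0 S) :=
    fun hS hST t ht => ((hX _ (hS.trans hST) t ⟨ht.1, ht.2.trans hST⟩).continuousWithinAt).mono
      (Set.Icc_subset_Icc_right hST)
  have huniq : ∀ {T S : ℝ}, 0 ≤ S → S ≤ T → Set.EqOn (X S) (X T) (Set.Icc 0 S) :=
    fun {T S} hS hST => ODE_solution_unique (v := fun _ => velocity w b ε) (fun _ => hK)
      (hcont hS le_rfl) (hright hS le_rfl) (hcont hS hST) (hright hS hST) (by rw [hX0, hX0])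
  -- By uniqueness this diagonal coincides with `X (t + 1)` on `[0, t + 1]`; the extra unit of time
  -- makes this interval a neighbourhood of `t` within `[0, ∞)`.
  refine ⟨fun t => X t t, fun i => by rw [hX0], fun t ht i => ?_⟩
  have h1 := hasDerivWithinAt_pi.1
    (hX (t + 1) (by linarith) t ⟨ht, by linarith⟩) i
  have heq : ∀ s ∈ Set.Icc 0 (t + 1), X s s = X (t + 1) s := fun s hs =>
    huniq hs.1 hs.2 ⟨hs.1, le_rfl⟩
  have h2 : HasDerivWithinAt (fun s => X s s i) (velocity w b ε (X (t + 1) t) i)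
      (Set.Icc 0 (t + 1)) t :=
    h1.congr (fun s hs => by rw [heq s hs]) (by rw [heq t ⟨ht, by linarith⟩])
  rw [heq t ⟨ht, by linarith⟩]
  refine h2.mono_of_mem_nhdsWithin ?_
  filter_upwards [inter_mem_nhdsWithin (Set.Ici 0) (Iio_mem_nhds (lt_add_one t))] with s hs
  exact ⟨hs.1, le_of_lt hs.2⟩

lemma IsTrajectory.hasDerivWithinAt_Icc {x₀ : ι → ℝ} {x : ℝ → ι → ℝ}
    (h : IsTrajectory w b ε x₀ x) {t₀ t₁ : ℝ} (ht₀ : 0 ≤ t₀) :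
    ∀ t ∈ Set.Icc t₀ t₁, ∀ i,
      HasDerivWithinAt (fun s => x s i) (velocity w b ε (x t) i) (Set.Icc t₀ t₁) t :=
  fun t ht i => (h.deriv t (ht₀.trans ht.1) i).mono fun _ hs => ht₀.trans hs.1

lemma IsTrajectory.neg (hε : 0 < ε) {x₀ : ι → ℝ} {x : ℝ → ι → ℝ}
    (h : IsTrajectory w b ε x₀ x) :
    IsTrajectory w b ε (fun i => -x₀ i) (fun t i => -x t i) where
  initial i := by rw [h.initial]
  deriv t ht i := by rw [velocity_neg hε]; exact (h.deriv t ht i).neg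

end Velocity

/-! ### Convergence to consensus -/

lemma hasDerivWithinAt_add_mul_exp (c m k T : ℝ) (s : Set ℝ) (t : ℝ) :
    HasDerivWithinAt (fun t => c + m * Real.exp (-k * (t - T)))
      (-k * (m * Real.exp (-k * (t - T)))) s t := by
  have h1 : HasDerivAt (fun t => -k * (t - T)) (-k) t := by
    simpa using ((hasDerivAt_id t).sub_const T).const_mul (-k)
  have := ((h1.exp.const_mul m).const_add c).hasDerivWithinAt (s := s)
  exact this.congr_deriv (by ring)

lemma tendsto_add_mul_exp (c m T : ℝ) {k : ℝ} (hk : 0 < k) :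
    Tendsto (fun t => c + m * Real.exp (-k * (t - T))) atTop (𝓝 c) := by
  have h1 : Tendsto (fun t : ℝ => -k * (t - T)) atTop atBot :=
    (tendsto_atTop_add_const_right atTop (-T) tendsto_id).const_mul_atTop_of_neg (by linarith)
  have := ((Real.tendsto_exp_atBot.comp h1).const_mul m).const_add c
  simpa using this

/-- Once all opinions exceed `ε`, they converge to `1`. -/
lemma IsTrajectory.tendsto_one {ι : Type*} [Fintype ι] [DecidableEq ι] {w : ι → ι → ℝ}
    {b ε m : ℝ} {x₀ : ι → ℝ} {x : ℝ → ι → ℝ} (h : IsTrajectory w b ε x₀ x)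
    (hw : ∀ i j, 0 ≤ w i j) (hb : 0 < b) (hε : 0 < ε) {T : ℝ} (hT : 0 ≤ T) (hm : ε < m)
    (hm1 : m ≤ 1) (hx : ∀ i, m ≤ x T i) (i : ι) :
    Tendsto (fun t => x t i) atTop (𝓝 1) := by
  have hexp1 : ∀ t, T ≤ t → Real.exp (-b * (t - T)) ≤ 1 := fun t ht => by
    rw [Real.exp_le_one_iff]; nlinarith
  -- The subsolution is the relaxation from `m` to `1`, lowered by `ρ`. Lowering makes the
  -- inequality strict by `b * ρ`, and `ρ ≤ m - ε` keeps it in the range where `sgnEps ε` equals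
  -- `1`.
  have hlow : ∀ ρ, 0 < ρ → ρ ≤ m - ε → ∀ t, T ≤ t →
      (1 - ρ) + (-(1 - m)) * Real.exp (-b * (t - T)) < x t i := by
    intro ρ hρ hρm t ht
    refine lt_of_lt_velocity (t₀ := T) (t₁ := t)
      (U := fun t _ => (1 - ρ) + (-(1 - m)) * Real.exp (-b * (t - T)))
      (U' := fun t _ => -b * ((-(1 - m)) * Real.exp (-b * (t - T)))) hw hε
      (h.hasDerivWithinAt_Icc hT) (fun s _ _ => hasDerivWithinAt_add_mul_exp _ _ _ _ _ _)
      (fun j => ?_) (fun s hs j => ?_) t ⟨ht, le_rfl⟩ i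
    · simp only [sub_self, mul_zero, Real.exp_zero]
      linarith [hx j]
    · have h1 := hexp1 s hs.1
      rw [velocity_const, sgnEps_of_ge hε (by nlinarith)]
      nlinarith
  obtain ⟨M, hM0, hM⟩ : ∃ M, 0 ≤ M ∧ ∀ j, x T j ≤ 1 + M := by
    refine ⟨‖x T‖, norm_nonneg _, fun j => ?_⟩
    have := norm_le_pi_norm (x T) j
    rw [Real.norm_eq_abs] at this
    linarith [le_abs_self (x T j)]
  have hup : ∀ ρ, 0 < ρ → ∀ t, T ≤ t → x t i < (1 + ρ) + M * Real.exp (-b * (t - T)) := by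
    intro ρ hρ t ht
    refine lt_of_velocity_lt (t₀ := T) (t₁ := t)
      (U := fun t _ => (1 + ρ) + M * Real.exp (-b * (t - T)))
      (U' := fun t _ => -b * (M * Real.exp (-b * (t - T)))) hw
      (h.hasDerivWithinAt_Icc hT) (fun s _ _ => hasDerivWithinAt_add_mul_exp _ _ _ _ _ _)
      (fun j => ?_) (fun s hs j => ?_) t ⟨ht, le_rfl⟩ i
    · simp only [sub_self, mul_zero, Real.exp_zero]
      linarith [hM j]
    · rw [velocity_const]
      have h1 := sgnEps_le_one hε ((1 + ρ) + M * Real.exp (-b * (s - T)))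
      nlinarith
  refine tendsto_order.2 ⟨fun a' ha' => ?_, fun a' ha' => ?_⟩
  · set ρ := min ((1 - a') / 2) (m - ε) with hρ
    have hρ0 : 0 < ρ := lt_min (by linarith) (by linarith)
    have hρ1 : ρ ≤ (1 - a') / 2 := min_le_left _ _
    filter_upwards [(tendsto_add_mul_exp (1 - ρ) (-(1 - m)) T hb).eventually
      (lt_mem_nhds (show a' < 1 - ρ by linarith)), eventually_ge_atTop T] with t h1 h2
    exact h1.trans (hlow ρ hρ0 (min_le_right _ _) t h2)
  · set ρ := (a' - 1) / 2 with hρ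
    filter_upwards [(tendsto_add_mul_exp (1 + ρ) M T hb).eventually
      (gt_mem_nhds (show 1 + ρ < a' by linarith)), eventually_ge_atTop T] with t h1 h2
    exact (hup ρ (by linarith) t h2).trans h1

/-! ### The two-agent system: symmetries -/

section TwoAgents

variable {a b ε x₁ x₂ : ℝ}

lemma velocity_two_zero (x : Fin 2 → ℝ) :
    velocity (fun _ _ : Fin 2 => a) b ε x 0 = a * (x 1 - x 0) + b * (sgnEps ε (x 0) - x 0) := by
  have : (Finset.univ.erase 0 : Finset (Fin 2)) = {1} := by decide
  simp [velocity, this]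

lemma velocity_two_one (x : Fin 2 → ℝ) :
    velocity (fun _ _ : Fin 2 => a) b ε x 1 = a * (x 0 - x 1) + b * (sgnEps ε (x 1) - x 1) := by
  have : (Finset.univ.erase 1 : Finset (Fin 2)) = {0} := by decide
  simp [velocity, this]

lemma IsTwoAgentTrajectory.neg (hε : 0 < ε) {y : ℝ → Fin 2 → ℝ}
    (h : IsTwoAgentTrajectory a b ε x₁ x₂ y) :
    IsTwoAgentTrajectory a b ε (-x₁) (-x₂) (fun t i => -y t i) := by
  have := IsTrajectory.neg hε h
  unfold IsTwoAgentTrajectory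
  convert this using 1
  ext i; fin_cases i <;> rfl

lemma IsTwoAgentTrajectory.swap {y : ℝ → Fin 2 → ℝ}
    (h : IsTwoAgentTrajectory a b ε x₁ x₂ y) :
    IsTwoAgentTrajectory a b ε x₂ x₁ (fun t => ![y t 1, y t 0]) where
  initial i := by
    have h0 := h.initial 0
    have h1 := h.initial 1
    simp only [Matrix.cons_val_zero, Matrix.cons_val_one] at h0 h1
    fin_cases i <;> simp [h0, h1]
  deriv t ht i := by
    have h0 := h.deriv t ht 0
    have h1 := h.deriv t ht 1
    rw [velocity_two_zero] at h0
    rw [velocity_two_one] at h1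
    fin_cases i
    · simpa [velocity_two_zero] using h1
    · simpa [velocity_two_one] using h0

lemma exists_isTwoAgentTrajectory (ha : 0 < a) (hb : 0 < b) (hε : 0 < ε) (x₁ x₂ : ℝ) :
    ∃ y, IsTwoAgentTrajectory a b ε x₁ x₂ y :=
  exists_isTrajectory (fun _ _ => ha.le) hb hε _

/-- The two-agent system has, for all small `ε`, an equilibrium that does not depend on `ε` and
near which `sgnEps ε` is constant. -/
def HasRobustEquilibrium (a b x₁ x₂ : ℝ) : Prop :=
  ∃ e₁ e₂ σ₁ σ₂ ε₀ r : ℝ, 0 < ε₀ ∧ 0 < r ∧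
    a * (e₂ - e₁) + b * (σ₁ - e₁) = 0 ∧ a * (e₁ - e₂) + b * (σ₂ - e₂) = 0 ∧
    ∀ ε, 0 < ε → ε < ε₀ → IsTwoAgentEquilibrium a b ε x₁ x₂ e₁ e₂ ∧
      (∀ z, |z - e₁| ≤ r → sgnEps ε z = σ₁) ∧ (∀ z, |z - e₂| ≤ r → sgnEps ε z = σ₂)

lemma HasRobustEquilibrium.swap (h : HasRobustEquilibrium a b x₁ x₂) :
    HasRobustEquilibrium a b x₂ x₁ := by
  obtain ⟨e₁, e₂, σ₁, σ₂, ε₀, r, hε₀, hr, h1, h2, h⟩ := h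
  refine ⟨e₂, e₁, σ₂, σ₁, ε₀, r, hε₀, hr, h2, h1, fun ε hε hεlt => ?_⟩
  obtain ⟨⟨⟨y, hy⟩, ht⟩, hs1, hs2⟩ := h ε hε hεlt
  exact ⟨⟨⟨_, hy.swap⟩, fun z hz => (ht _ hz.swap).symm⟩, hs2, hs1⟩

lemma HasRobustEquilibrium.neg (h : HasRobustEquilibrium a b x₁ x₂) :
    HasRobustEquilibrium a b (-x₁) (-x₂) := by
  obtain ⟨e₁, e₂, σ₁, σ₂, ε₀, r, hε₀, hr, h1, h2, h⟩ := h
  refine ⟨-e₁, -e₂, -σ₁, -σ₂, ε₀, r, hε₀, hr, by linarith, by linarith, fun ε hε hεlt => ?_⟩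
  obtain ⟨⟨⟨y, hy⟩, ht⟩, hs1, hs2⟩ := h ε hε hεlt
  refine ⟨⟨⟨_, hy.neg hε⟩, fun z hz => ?_⟩, fun z hz => ?_, fun z hz => ?_⟩
  · have hz' := hz.neg hε
    rw [neg_neg, neg_neg] at hz'
    have := ht _ hz'
    exact ⟨by simpa using this.1.neg, by simpa using this.2.neg⟩
  · rw [← hs1 (-z) (by rw [← abs_neg]; convert hz using 2; ring), sgnEps_neg hε, neg_neg]
  · rw [← hs2 (-z) (by rw [← abs_neg]; convert hz using 2; ring), sgnEps_neg hε, neg_neg]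

/-! ### The solution for agents on different sides of the platform -/

/-- The first coordinate of the solution of `ẏ₁ = a(y₂ - y₁) + b(1 - y₁)`,
`ẏ₂ = a(y₁ - y₂) + b(-1 - y₂)`. -/
noncomputable def splitFst (a b x₁ x₂ t : ℝ) : ℝ :=
  b / (2 * a + b) + ((x₁ + x₂) * Real.exp (-b * t) +
    (x₁ - x₂ - 2 * b / (2 * a + b)) * Real.exp (-(2 * a + b) * t)) / 2

/-- The second coordinate of the solution of `ẏ₁ = a(y₂ - y₁) + b(1 - y₁)`,
`ẏ₂ = a(y₁ - y₂) + b(-1 - y₂)`. -/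
noncomputable def splitSnd (a b x₁ x₂ t : ℝ) : ℝ :=
  -(b / (2 * a + b)) + ((x₁ + x₂) * Real.exp (-b * t) -
    (x₁ - x₂ - 2 * b / (2 * a + b)) * Real.exp (-(2 * a + b) * t)) / 2

lemma hasDerivAt_exp_mul (k t : ℝ) :
    HasDerivAt (fun t => Real.exp (k * t)) (k * Real.exp (k * t)) t := by
  have := ((hasDerivAt_id t).const_mul k).exp
  simpa [mul_comm] using this

lemma tendsto_exp_neg_mul {k : ℝ} (hk : 0 < k) :
    Tendsto (fun t => Real.exp (-k * t)) atTop (𝓝 0) :=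
  Real.tendsto_exp_atBot.comp (tendsto_id.const_mul_atTop_of_neg (by linarith))

lemma hasDerivAt_splitFst (hab : 2 * a + b ≠ 0) (t : ℝ) :
    HasDerivAt (splitFst a b x₁ x₂) (a * (splitSnd a b x₁ x₂ t - splitFst a b x₁ x₂ t) +
      b * (1 - splitFst a b x₁ x₂ t)) t := by
  have := ((((hasDerivAt_exp_mul (-b) t).const_mul (x₁ + x₂)).add
    ((hasDerivAt_exp_mul (-(2 * a + b)) t).const_mul
      (x₁ - x₂ - 2 * b / (2 * a + b)))).div_const 2).const_add (b / (2 * a + b))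
  refine HasDerivAt.congr_deriv this ?_
  unfold splitFst splitSnd
  field_simp
  ring

lemma hasDerivAt_splitSnd (hab : 2 * a + b ≠ 0) (t : ℝ) :
    HasDerivAt (splitSnd a b x₁ x₂) (a * (splitFst a b x₁ x₂ t - splitSnd a b x₁ x₂ t) +
      b * (-1 - splitSnd a b x₁ x₂ t)) t := by
  have := ((((hasDerivAt_exp_mul (-b) t).const_mul (x₁ + x₂)).sub
    ((hasDerivAt_exp_mul (-(2 * a + b)) t).const_mul
      (x₁ - x₂ - 2 * b / (2 * a + b)))).div_const 2).const_add (-(b / (2 * a + b)))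
  refine HasDerivAt.congr_deriv this ?_
  unfold splitFst splitSnd
  field_simp
  ring

lemma splitFst_zero (a b x₁ x₂ : ℝ) : splitFst a b x₁ x₂ 0 = x₁ := by
  simp only [splitFst, mul_zero, Real.exp_zero]; ring

lemma splitSnd_zero (a b x₁ x₂ : ℝ) : splitSnd a b x₁ x₂ 0 = x₂ := by
  simp only [splitSnd, mul_zero, Real.exp_zero]; ring

lemma tendsto_splitFst (ha : 0 < a) (hb : 0 < b) :
    Tendsto (splitFst a b x₁ x₂) atTop (𝓝 (b / (2 * a + b))) := by
  have := ((((tendsto_exp_neg_mul hb).const_mul (x₁ + x₂)).add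
    ((tendsto_exp_neg_mul (show 0 < 2 * a + b by linarith)).const_mul
      (x₁ - x₂ - 2 * b / (2 * a + b)))).div_const 2).const_add (b / (2 * a + b))
  rw [mul_zero, mul_zero, add_zero, zero_div, add_zero] at this
  exact this

lemma tendsto_splitSnd (ha : 0 < a) (hb : 0 < b) :
    Tendsto (splitSnd a b x₁ x₂) atTop (𝓝 (-(b / (2 * a + b)))) := by
  have := ((((tendsto_exp_neg_mul hb).const_mul (x₁ + x₂)).sub
    ((tendsto_exp_neg_mul (show 0 < 2 * a + b by linarith)).const_mul
      (x₁ - x₂ - 2 * b / (2 * a + b)))).div_const 2).const_add (-(b / (2 * a + b)))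
  rw [mul_zero, mul_zero, sub_zero, zero_div, add_zero] at this
  exact this

/-- Expresses both decay rates through `u = exp (-b t)`, which turns the question of crossing zero
into a one-variable inequality on `[0, 1]`. -/
lemma exp_neg_mul_rpow (hb : 0 < b) (a t : ℝ) :
    Real.exp (-(2 * a + b) * t) = Real.exp (-b * t) ^ (1 + 2 * a / b) := by
  rw [← Real.exp_mul]
  congr 1
  field_simp
  ring

/-- While the first agent is above `ε`, the solution stays above the split solution. -/
lemma IsTwoAgentTrajectory.split_sub_lt (ha : 0 < a) (hb : 0 < b) (hε : 0 < ε) {ρ : ℝ}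
    (hρ : 0 < ρ) {y : ℝ → Fin 2 → ℝ} (h : IsTwoAgentTrajectory a b ε x₁ x₂ y) {T : ℝ}
    (hsplit : ∀ t ∈ Set.Icc 0 T, ε ≤ splitFst a b x₁ x₂ t - ρ) :
    ∀ t ∈ Set.Icc 0 T, splitFst a b x₁ x₂ t - ρ < y t 0 ∧ splitSnd a b x₁ x₂ t - ρ < y t 1 := by
  have hab : 2 * a + b ≠ 0 := by positivity
  have h0 := h.initial 0
  have h1 := h.initial 1
  simp only [Matrix.cons_val_zero, Matrix.cons_val_one] at h0 h1
  -- Lowering both coordinates by `ρ` leaves their coupling unchanged and adds `b * ρ` to the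
  -- velocity, which gives strictness. For the second agent the bound `-1 ≤ sgnEps` suffices, so its
  -- side does not matter.
  have := lt_of_lt_velocity (w := fun _ _ : Fin 2 => a) (b := b) (ε := ε) (x := y)
    (U := fun t => ![splitFst a b x₁ x₂ t - ρ, splitSnd a b x₁ x₂ t - ρ])
    (U' := fun t => ![a * (splitSnd a b x₁ x₂ t - splitFst a b x₁ x₂ t) +
      b * (1 - splitFst a b x₁ x₂ t), a * (splitFst a b x₁ x₂ t - splitSnd a b x₁ x₂ t) +
      b * (-1 - splitSnd a b x₁ x₂ t)]) (t₀ := 0) (t₁ := T) (fun _ _ => ha.le) hε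
    (h.hasDerivWithinAt_Icc le_rfl)
    (fun t _ i => by
      fin_cases i
      · exact ((hasDerivAt_splitFst hab t).sub_const ρ).hasDerivWithinAt
      · exact ((hasDerivAt_splitSnd hab t).sub_const ρ).hasDerivWithinAt)
    (fun i => by
      fin_cases i
      · simp [h0, splitFst_zero, hρ]
      · simp [h1, splitSnd_zero, hρ])
    (fun t ht i => by
      fin_cases i
      · simp only [Fin.zero_eta, Fin.isValue, velocity_two_zero, Matrix.cons_val_zero,
          Matrix.cons_val_one]
        rw [sgnEps_of_ge hε (hsplit t ht)]
        nlinarith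
      · simp only [Fin.mk_one, Fin.isValue, velocity_two_one, Matrix.cons_val_zero,
          Matrix.cons_val_one]
        have := neg_one_le_sgnEps hε (splitSnd a b x₁ x₂ t - ρ)
        nlinarith)
  exact fun t ht => ⟨this t ht 0, this t ht 1⟩

/-- While the second agent is below `-ε`, the solution stays below the split solution. -/
lemma IsTwoAgentTrajectory.lt_split_add (ha : 0 < a) (hb : 0 < b) (hε : 0 < ε) {ρ : ℝ}
    (hρ : 0 < ρ) {y : ℝ → Fin 2 → ℝ} (h : IsTwoAgentTrajectory a b ε x₁ x₂ y) {T : ℝ}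
    (hsplit : ∀ t ∈ Set.Icc 0 T, splitSnd a b x₁ x₂ t + ρ ≤ -ε) :
    ∀ t ∈ Set.Icc 0 T, y t 0 < splitFst a b x₁ x₂ t + ρ ∧ y t 1 < splitSnd a b x₁ x₂ t + ρ := by
  have hFst : ∀ t, splitFst a b (-x₂) (-x₁) t = -splitSnd a b x₁ x₂ t := fun t => by
    unfold splitFst splitSnd; ring
  have hSnd : ∀ t, splitSnd a b (-x₂) (-x₁) t = -splitFst a b x₁ x₂ t := fun t => by
    unfold splitFst splitSnd; ring
  intro t ht
  have := (h.swap.neg hε).split_sub_lt ha hb hε hρ (T := T)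
    (fun t ht => by rw [hFst]; linarith [hsplit t ht]) t ht
  simp only [hFst, hSnd, Matrix.cons_val_zero, Matrix.cons_val_one] at this
  exact ⟨by linarith [this.2], by linarith [this.1]⟩

/-! ### Polarization and consensus of the two-agent system -/

/-- The hypothesis `h1` is positivity at `u = 1`. If `0 ≤ X < b S`, Bernoulli's inequality (the
tangent of the power at `u = 1`) shows that the expression is at least its value at `1`; for `X < 0`
the power is replaced by `u`. If `X` exceeds `K`, the tangent is taken at `u = b / (a S)`: for `X =
K` the expression has a double zero there, which explains the threshold. -/
lemma split_pos_of_conditionPD {X S : ℝ} (ha : 0 < a) (hb : 0 < b) (hS : 0 ≤ S)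
    (h1 : b * (1 + 2 * a / b) * S < X + 2 * b)
    (h : X < b * S ∨ b ^ (1 - 2 * a / b) * a ^ (2 * a / b) * S ^ (1 + 2 * a / b) < X)
    {u : ℝ} (hu0 : 0 ≤ u) (hu1 : u ≤ 1) :
    0 < 2 * b + X * u ^ (1 + 2 * a / b) - b * (1 + 2 * a / b) * S * u := by
  set γ := 2 * a / b with hγ
  have hγ0 : 0 < γ := by positivity
  have hbγ : b * γ = 2 * a := by rw [hγ]; field_simp
  have hup : u ^ (1 + γ) ≤ u := by
    rcases hu0.eq_or_lt with h0 | h0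
    · rw [← h0, Real.zero_rpow (by positivity)]
    · calc u ^ (1 + γ) ≤ u ^ (1 : ℝ) :=
          Real.rpow_le_rpow_of_exponent_ge h0 hu1 (by linarith)
        _ = u := Real.rpow_one u
  have hup0 : 0 ≤ u ^ (1 + γ) := Real.rpow_nonneg hu0 _
  rcases h with h | h
  · rcases le_or_gt 0 X with hX | hX
    · have hB := one_add_mul_self_le_rpow_one_add (s := u - 1) (by linarith)
        (p := 1 + γ) (by linarith)
      rw [add_sub_cancel] at hB
      have h2 := mul_le_mul_of_nonneg_left hB hX
      have h3 : 0 ≤ (1 + γ) * (1 - u) * (b * S - X) := by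
        have : 0 ≤ 1 - u := by linarith
        have : 0 ≤ b * S - X := by linarith
        positivity
      nlinarith
    · have h2 : X * u ≤ X * u ^ (1 + γ) := mul_le_mul_of_nonpos_left hup hX.le
      rcases hu1.eq_or_lt with h3 | h3
      · subst h3; rw [Real.one_rpow]; linarith
      · nlinarith [mul_nonneg hu0 (sub_nonneg.2 h1.le)]
  · have hK0 : 0 ≤ b ^ (1 - γ) * a ^ γ * S ^ (1 + γ) := by positivity
    rcases hu0.eq_or_lt with h0 | h0
    · rw [← h0, Real.zero_rpow (by positivity)]; linarith
    rcases hS.eq_or_lt with hS0 | hS0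
    · rw [← hS0]
      have : 0 ≤ X * u ^ (1 + γ) := mul_nonneg (by linarith) hup0
      linarith
    have hB := one_add_mul_self_le_rpow_one_add (s := u * (a * S) / b - 1) (by
      have : 0 ≤ u * (a * S) / b := by positivity
      linarith) (p := 1 + γ) (by linarith)
    rw [add_sub_cancel, Real.div_rpow (by positivity) hb.le, Real.mul_rpow hu0 (by positivity),
      Real.mul_rpow ha.le hS, Real.rpow_add ha, Real.rpow_one, le_div_iff₀ (by positivity)] at hB
    have hbb : b ^ (1 - γ) * b ^ (1 + γ) = b ^ 2 := by
      rw [← Real.rpow_add hb, ← Real.rpow_natCast]; norm_num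
    have hpos : 0 < b ^ (1 - γ) := by positivity
    have h2 := mul_le_mul_of_nonneg_left hB hpos.le
    have h3 : b ^ (1 - γ) * ((1 + (1 + γ) * (u * (a * S) / b - 1)) * b ^ (1 + γ)) =
        a * (b * (1 + γ) * S * u - 2 * b) := by
      calc _ = (b ^ (1 - γ) * b ^ (1 + γ)) * (1 + (1 + γ) * (u * (a * S) / b - 1)) := by ring
        _ = _ := by
          rw [hbb]
          field_simp
          linear_combination -hbγ
    rw [h3] at h2
    have h4 : b ^ (1 - γ) * (u ^ (1 + γ) * (a * a ^ γ * S ^ (1 + γ))) =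
        a * ((b ^ (1 - γ) * a ^ γ * S ^ (1 + γ)) * u ^ (1 + γ)) := by ring
    rw [h4] at h2
    have h5 := le_of_mul_le_mul_left h2 ha
    have h6 := mul_lt_mul_of_pos_right h (show 0 < u ^ (1 + γ) by positivity)
    linarith

/-- The witness `u = (b S / X) ^ (1 / γ)`, with `γ = 2a / b`, is the critical point of the
expression. It is below `1` because `b S < X`. The value there is `2b - 2a S u`, negative once `u >
b / (a S)`, and this is what `X < K` provides. -/
lemma exists_split_neg_of_conditionCO {X S : ℝ} (ha : 0 < a) (hb : 0 < b) (hS : 0 ≤ S)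
    (h1 : b * S < X)
    (h2 : X < b ^ (1 - 2 * a / b) * a ^ (2 * a / b) * S ^ (1 + 2 * a / b)) :
    0 < S ∧ ∃ u : ℝ, 0 < u ∧ u < 1 ∧
      2 * b + X * u ^ (1 + 2 * a / b) - b * (1 + 2 * a / b) * S * u < 0 := by
  set γ := 2 * a / b with hγ
  have hγ0 : 0 < γ := by positivity
  have hbγ : b * γ = 2 * a := by rw [hγ]; field_simp
  have hS0 : 0 < S := by
    rcases hS.eq_or_lt with h | h
    · rw [← h, Real.zero_rpow (by positivity)] at h2
      rw [← h] at h1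
      linarith
    · exact h
  refine ⟨hS0, ?_⟩
  have hX : 0 < X := lt_trans (by positivity) h1
  set u := (b * S / X) ^ (1 / γ) with hu
  have hq : 0 < b * S / X := by positivity
  have hu0 : 0 < u := by positivity
  have huγ : u ^ γ = b * S / X := by
    rw [hu, ← Real.rpow_mul hq.le, one_div_mul_cancel hγ0.ne', Real.rpow_one]
  refine ⟨u, hu0, ?_, ?_⟩
  · exact Real.rpow_lt_one hq.le (by rw [div_lt_one hX]; exact h1) (by positivity)
  · have hlt : b / (a * S) < u := by
      refine lt_of_not_ge fun hle => ?_
      have h3 := Real.rpow_le_rpow hu0.le hle hγ0.le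
      rw [huγ, Real.div_rpow hb.le (by positivity), Real.mul_rpow ha.le hS,
        div_le_div_iff₀ hX (by positivity)] at h3
      have h4 : b ^ (1 - γ) * a ^ γ * S ^ (1 + γ) * b ^ γ = b * S * (a ^ γ * S ^ γ) := by
        rw [Real.rpow_add hS0, Real.rpow_one, Real.rpow_sub hb, Real.rpow_one]
        field_simp
      have h5 := mul_lt_mul_of_pos_right h2 (show 0 < b ^ γ by positivity)
      rw [h4, mul_comm X] at h5
      linarith
    rw [Real.rpow_add hu0, Real.rpow_one, huγ]
    have h3 : X * (u * (b * S / X)) = u * (b * S) := by field_simp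
    rw [h3]
    rw [div_lt_iff₀ (by positivity)] at hlt
    have h4 : b * (1 + γ) * S * u = u * (b * S) + 2 * a * S * u := by
      linear_combination S * u * hbγ
    rw [h4]
    nlinarith

lemma HasRobustEquilibrium.of_pos (ha : 0 < a) (hb : 0 < b)
    (h : ∃ ε₀ > 0, ∀ ε, 0 < ε → ε < ε₀ → ∀ y, IsTwoAgentTrajectory a b ε x₁ x₂ y →
      ∃ T, 0 ≤ T ∧ ∃ m, ε < m ∧ m ≤ 1 ∧ m ≤ y T 0 ∧ m ≤ y T 1) :
    HasRobustEquilibrium a b x₁ x₂ := by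
  obtain ⟨ε₀, hε₀, h⟩ := h
  refine ⟨1, 1, 1, 1, min ε₀ (1 / 2), 1 / 2, lt_min hε₀ (by norm_num), by norm_num,
    by ring, by ring, fun ε hε hεlt => ?_⟩
  have hs : ∀ z : ℝ, |z - 1| ≤ 1 / 2 → sgnEps ε z = 1 := fun z hz => by
    have h1 := (abs_le.1 hz).1
    have h2 := hεlt.trans_le (min_le_right _ _)
    exact sgnEps_of_ge hε (by linarith)
  refine ⟨⟨exists_isTwoAgentTrajectory ha hb hε _ _, fun y hy => ?_⟩, hs, hs⟩
  obtain ⟨T, hT, m, hm, hm1, h0, h1⟩ := h ε hε (hεlt.trans_le (min_le_left _ _)) y hy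
  have := IsTrajectory.tendsto_one hy (fun _ _ => ha.le) hb hε hT hm hm1
    (fun i => by fin_cases i; exacts [h0, h1])
  exact ⟨this 0, this 1⟩

lemma hasRobustEquilibrium_of_pos (ha : 0 < a) (hb : 0 < b) (h1 : 0 < x₁) (h2 : 0 < x₂) :
    HasRobustEquilibrium a b x₁ x₂ := by
  refine .of_pos ha hb ⟨min 1 (min x₁ x₂), by positivity, fun ε hε hεlt y hy =>
    ⟨0, le_rfl, min 1 (min x₁ x₂), hεlt, min_le_left _ _, ?_, ?_⟩⟩
  · have := hy.initial 0
    simp only [Matrix.cons_val_zero] at this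
    rw [this]; exact (min_le_right _ _).trans (min_le_left _ _)
  · have := hy.initial 1
    simp only [Matrix.cons_val_one] at this
    rw [this]; exact (min_le_right _ _).trans (min_le_right _ _)

/-- At the time `T` with `exp (-b T) = u` the second split coordinate is positive, while the first
has stayed above `(x₁ + x₂) u / 2`. The split solution, lowered slightly, is a lower barrier, so for
small `ε` both agents exceed `ε` at `T` and then converge to `1`. -/
lemma hasRobustEquilibrium_of_between (ha : 0 < a) (hb : 0 < b) (hS : 0 ≤ x₁ + x₂)
    (h1 : b * (x₁ + x₂) < (2 * a + b) * (x₁ - x₂) - 2 * b)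
    (h2 : (2 * a + b) * (x₁ - x₂) - 2 * b <
      b ^ (1 - 2 * a / b) * a ^ (2 * a / b) * (x₁ + x₂) ^ (1 + 2 * a / b)) :
    HasRobustEquilibrium a b x₁ x₂ := by
  obtain ⟨hS0, u, hu0, hu1, hneg⟩ := exists_split_neg_of_conditionCO ha hb hS h1 h2
  have hk : 0 < 2 * a + b := by positivity
  set T := -Real.log u / b with hTdef
  have hlog : Real.log u < 0 := Real.log_neg hu0 hu1
  have hT : 0 ≤ T := div_nonneg (by linarith) hb.le
  have hexpT : Real.exp (-b * T) = u := by
    rw [hTdef, show -b * (-Real.log u / b) = Real.log u by field_simp, Real.exp_log hu0]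
  have hXk : x₁ - x₂ - 2 * b / (2 * a + b) =
      ((2 * a + b) * (x₁ - x₂) - 2 * b) / (2 * a + b) := by field_simp
  have hX0 : 0 < (2 * a + b) * (x₁ - x₂) - 2 * b := lt_of_le_of_lt (by positivity) h1
  have hfst : ∀ t ∈ Set.Icc 0 T, (x₁ + x₂) * u / 2 < splitFst a b x₁ x₂ t := by
    intro t ht
    unfold splitFst
    rw [hXk]
    have h3 : u ≤ Real.exp (-b * t) := by
      rw [← hexpT]; exact Real.exp_le_exp.2 (by nlinarith [ht.2])
    have h4 := mul_le_mul_of_nonneg_left h3 hS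
    have h5 : 0 < b / (2 * a + b) := by positivity
    have h6 : 0 < ((2 * a + b) * (x₁ - x₂) - 2 * b) / (2 * a + b) *
      Real.exp (-(2 * a + b) * t) := by positivity
    linarith
  have hsnd : 0 < splitSnd a b x₁ x₂ T := by
    unfold splitSnd
    rw [exp_neg_mul_rpow hb a T, hexpT, hXk]
    have hbγ : b * (1 + 2 * a / b) = 2 * a + b := by field_simp; ring
    rw [hbγ] at hneg
    have : -(b / (2 * a + b)) + ((x₁ + x₂) * u - ((2 * a + b) * (x₁ - x₂) - 2 * b) / (2 * a + b) *
        u ^ (1 + 2 * a / b)) / 2 = -(2 * b + ((2 * a + b) * (x₁ - x₂) - 2 * b) *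
        u ^ (1 + 2 * a / b) - (2 * a + b) * (x₁ + x₂) * u) / (2 * (2 * a + b)) := by
      field_simp
      ring
    rw [this]
    exact div_pos (by linarith) (by positivity)
  set c := min (min (splitSnd a b x₁ x₂ T) ((x₁ + x₂) * u / 2)) 1 with hc
  have hc0 : 0 < c := by positivity
  have hc1 : c ≤ splitSnd a b x₁ x₂ T := (min_le_left _ _).trans (min_le_left _ _)
  have hc2 : c ≤ (x₁ + x₂) * u / 2 := (min_le_left _ _).trans (min_le_right _ _)
  have hc3 : c ≤ 1 := min_le_right _ _
  refine .of_pos ha hb ⟨c / 2, by positivity, fun ε hε hεlt y hy =>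
    ⟨T, hT, c / 2, hεlt, by linarith, ?_⟩⟩
  have := hy.split_sub_lt ha hb hε (ρ := c / 2) (by positivity) (T := T)
    (fun t ht => by linarith [hfst t ht]) T ⟨hT, le_rfl⟩
  have h3 := hfst T ⟨hT, le_rfl⟩
  exact ⟨by linarith [this.1], by linarith [this.2]⟩

/-- By compactness the positive expression has a minimum `M > 0` on `[0, 1]`, which keeps both split
coordinates at distance `2κ` from zero for all times; using `|x₁ + x₂|` treats both agents at once.
For `ε < κ` the upper and lower barriers at distance `ρ` are valid for every `ρ < κ`, and `ρ → 0`
identifies the trajectory with the split solution. -/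
lemma hasRobustEquilibrium_of_split (ha : 0 < a) (hb : 0 < b) (h1 : 0 < x₁) (h2 : x₂ < 0)
    (h : (2 * a + b) * (x₁ - x₂) - 2 * b < b * |x₁ + x₂| ∨
      b ^ (1 - 2 * a / b) * a ^ (2 * a / b) * |x₁ + x₂| ^ (1 + 2 * a / b) <
        (2 * a + b) * (x₁ - x₂) - 2 * b) :
    HasRobustEquilibrium a b x₁ x₂ := by
  have hk : 0 < 2 * a + b := by positivity
  have hbγ : b * (1 + 2 * a / b) = 2 * a + b := by field_simp; ring
  have hγ : 0 < 1 + 2 * a / b := by positivity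
  set X := (2 * a + b) * (x₁ - x₂) - 2 * b with hX
  set S := |x₁ + x₂| with hS
  have hSlt : S < x₁ - x₂ := by rw [hS, abs_lt]; constructor <;> linarith
  have hpos : ∀ u ∈ Set.Icc (0 : ℝ) 1, 0 < 2 * b + X * u ^ (1 + 2 * a / b) -
      b * (1 + 2 * a / b) * S * u := fun u hu =>
    split_pos_of_conditionPD ha hb (abs_nonneg _) (by
      rw [hbγ, hX]; nlinarith) h hu.1 hu.2
  obtain ⟨u₀, hu₀, hmin⟩ := isCompact_Icc.exists_isMinOn (Set.nonempty_Icc.2 zero_le_one)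
    (f := fun u : ℝ => 2 * b + X * u ^ (1 + 2 * a / b) - b * (1 + 2 * a / b) * S * u)
    (by
      refine Continuous.continuousOn ?_
      have : Continuous fun u : ℝ => u ^ (1 + 2 * a / b) :=
        Real.continuous_rpow_const hγ.le
      fun_prop)
  set M := 2 * b + X * u₀ ^ (1 + 2 * a / b) - b * (1 + 2 * a / b) * S * u₀ with hM
  have hM0 : 0 < M := hpos u₀ hu₀
  set κ := M / (4 * (2 * a + b)) with hκ
  have hκ0 : 0 < κ := by positivity
  have hXk : x₁ - x₂ - 2 * b / (2 * a + b) = X / (2 * a + b) := by rw [hX]; field_simp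
  have hsplit : ∀ t, 0 ≤ t → 2 * κ ≤ splitFst a b x₁ x₂ t ∧ splitSnd a b x₁ x₂ t ≤ -(2 * κ) := by
    intro t ht
    have hu : Real.exp (-b * t) ∈ Set.Icc (0 : ℝ) 1 :=
      ⟨(Real.exp_pos _).le, by rw [Real.exp_le_one_iff]; nlinarith⟩
    have h3 := hmin hu
    simp only [Set.mem_ofPred_eq] at h3
    rw [← hM, ← exp_neg_mul_rpow hb a t, hbγ] at h3
    have h4 : (x₁ + x₂) * Real.exp (-b * t) ≤ S * Real.exp (-b * t) :=
      mul_le_mul_of_nonneg_right (le_abs_self _) hu.1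
    have h5 : -(S * Real.exp (-b * t)) ≤ (x₁ + x₂) * Real.exp (-b * t) := by
      rw [← neg_mul]; exact mul_le_mul_of_nonneg_right (neg_abs_le _) hu.1
    have h6 : 4 * κ ≤ 2 * (b / (2 * a + b)) + X / (2 * a + b) * Real.exp (-(2 * a + b) * t) -
        S * Real.exp (-b * t) := by
      have e1 : 4 * κ = M / (2 * a + b) := by rw [hκ]; field_simp
      have e2 : 2 * (b / (2 * a + b)) + X / (2 * a + b) * Real.exp (-(2 * a + b) * t) -
        S * Real.exp (-b * t) = (2 * b + X * Real.exp (-(2 * a + b) * t) -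
          (2 * a + b) * S * Real.exp (-b * t)) / (2 * a + b) := by field_simp
      rw [e1, e2]
      exact div_le_div_of_nonneg_right h3 hk.le
    unfold splitFst splitSnd
    rw [hXk]
    constructor <;> linarith
  have he : 2 * κ ≤ b / (2 * a + b) := by
    refine ge_of_tendsto (tendsto_splitFst (x₁ := x₁) (x₂ := x₂) ha hb) ?_
    filter_upwards [eventually_ge_atTop 0] with t ht using (hsplit t ht).1
  refine ⟨b / (2 * a + b), -(b / (2 * a + b)), 1, -1, κ, κ, hκ0, hκ0, by field_simp; ring,
    by field_simp; ring, fun ε hε hεlt => ⟨⟨exists_isTwoAgentTrajectory ha hb hε _ _,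
      fun y hy => ?_⟩, fun z hz => ?_, fun z hz => ?_⟩⟩
  · have hclose : ∀ t, 0 ≤ t → ∀ ρ, 0 < ρ → ρ < κ →
        (|y t 0 - splitFst a b x₁ x₂ t| ≤ ρ ∧ |y t 1 - splitSnd a b x₁ x₂ t| ≤ ρ) := by
      intro t ht ρ hρ hρκ
      have h3 := hy.split_sub_lt ha hb hε hρ (T := t)
        (fun s hs => by linarith [(hsplit s hs.1).1]) t ⟨ht, le_rfl⟩
      have h4 := hy.lt_split_add ha hb hε hρ (T := t)
        (fun s hs => by linarith [(hsplit s hs.1).2]) t ⟨ht, le_rfl⟩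
      exact ⟨abs_le.2 ⟨by linarith, by linarith⟩, abs_le.2 ⟨by linarith, by linarith⟩⟩
    have hzero : ∀ z : ℝ, (∀ ρ, 0 < ρ → ρ < κ → |z| ≤ ρ) → z = 0 := by
      intro z hz
      rw [← abs_nonpos_iff]
      refine le_of_forall_gt_imp_ge_of_dense fun ρ hρ => ?_
      exact (hz (min ρ (κ / 2)) (by positivity)
        ((min_le_right _ _).trans_lt (by linarith))).trans (min_le_left _ _)
    have heq : ∀ t, 0 ≤ t → y t 0 = splitFst a b x₁ x₂ t ∧ y t 1 = splitSnd a b x₁ x₂ t :=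
      fun t ht => ⟨sub_eq_zero.1 (hzero _ fun ρ h3 h4 => (hclose t ht ρ h3 h4).1),
        sub_eq_zero.1 (hzero _ fun ρ h3 h4 => (hclose t ht ρ h3 h4).2)⟩
    constructor
    · refine (tendsto_splitFst (x₁ := x₁) (x₂ := x₂) ha hb).congr' ?_
      filter_upwards [eventually_ge_atTop 0] with t ht using (heq t ht).1.symm
    · refine (tendsto_splitSnd (x₁ := x₁) (x₂ := x₂) ha hb).congr' ?_
      filter_upwards [eventually_ge_atTop 0] with t ht using (heq t ht).2.symm
  · exact sgnEps_of_ge hε (by linarith [(abs_le.1 hz).1])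
  · exact sgnEps_of_le (by linarith [(abs_le.1 hz).2])

theorem hasRobustEquilibrium_of_conditionPD (ha : 0 < a) (hb : 0 < b)
    (h : ConditionPD a b x₁ x₂) : HasRobustEquilibrium a b x₁ x₂ := by
  obtain ⟨hneg, h⟩ := h
  rcases mul_neg_iff.1 hneg with ⟨h1, h2⟩ | ⟨h1, h2⟩
  · rw [abs_of_pos (show 0 < x₁ - x₂ by linarith)] at h
    exact hasRobustEquilibrium_of_split ha hb h1 h2 h
  · rw [abs_of_neg (show x₁ - x₂ < 0 by linarith), neg_sub, add_comm x₁ x₂] at h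
    exact (hasRobustEquilibrium_of_split ha hb h2 h1 h).swap

theorem hasRobustEquilibrium_of_conditionCO (ha : 0 < a) (hb : 0 < b)
    (h : ConditionCO a b x₁ x₂) : HasRobustEquilibrium a b x₁ x₂ := by
  rcases h with h | h
  · rcases mul_pos_iff.1 h with ⟨h1, h2⟩ | ⟨h1, h2⟩
    · exact hasRobustEquilibrium_of_pos ha hb h1 h2
    · have := (hasRobustEquilibrium_of_pos (x₁ := -x₁) (x₂ := -x₂) ha hb
        (by linarith) (by linarith)).neg
      rwa [neg_neg, neg_neg] at this
  · have key : ∀ x₁ x₂ : ℝ, 0 ≤ x₁ + x₂ →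
        (b * |x₁ + x₂| < (2 * a + b) * |x₁ - x₂| - 2 * b ∧
        (2 * a + b) * |x₁ - x₂| - 2 * b <
          b ^ (1 - 2 * a / b) * a ^ (2 * a / b) * |x₁ + x₂| ^ (1 + 2 * a / b)) →
        HasRobustEquilibrium a b x₁ x₂ := by
      intro x₁ x₂ hS h
      rw [abs_of_nonneg hS] at h
      rcases le_total x₂ x₁ with hle | hle
      · rw [abs_of_nonneg (sub_nonneg.2 hle)] at h
        exact hasRobustEquilibrium_of_between ha hb hS h.1 h.2
      · rw [abs_of_nonpos (sub_nonpos.2 hle), neg_sub, add_comm x₁ x₂] at h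
        exact (hasRobustEquilibrium_of_between ha hb (by linarith) h.1 h.2).swap
    rcases le_total 0 (x₁ + x₂) with hS | hS
    · exact key _ _ hS h
    · have := (key (-x₁) (-x₂) (by linarith) (by
        rwa [← neg_add, abs_neg, show -x₁ - -x₂ = -(x₁ - x₂) by ring, abs_neg])).neg
      rwa [neg_neg, neg_neg] at this

end TwoAgents

/-! ### Opinion dynamics on balanced graphs -/

section Block

variable {n : ℕ} {a b ε : ℝ}

open Classical in
/-- The number of connections of an agent to agents of the other type. -/
noncomputable def crossDegree (G : SimpleGraph (Agent n)) (u : Agent n) : ℕ :=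
  (Finset.univ.filter fun v => G.Adj u v ∧ u.isLeft ≠ v.isLeft).card

open Classical in
/-- The fraction of connections of an agent that are to agents of the other type. -/
noncomputable def crossFraction (G : SimpleGraph (Agent n)) (u : Agent n) : ℝ :=
  crossDegree G u / G.degree u

/-- The graphs in which the fraction of connections to agents of the other type is within `δ` of
`β` for every agent. -/
def balancedGraphs (β δ : ℝ) (n : ℕ) : Set (SimpleGraph (Agent n)) :=
  {G | ∀ u, |crossFraction G u - β| ≤ δ}

lemma influence_nonneg (ha : 0 ≤ a) (G : SimpleGraph (Agent n)) (u v : Agent n) :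
    0 ≤ influence a G u v := by
  unfold influence
  split_ifs <;> positivity

lemma sum_influence_le (ha : 0 ≤ a) (G : SimpleGraph (Agent n)) (u : Agent n) :
    ∑ v ∈ Finset.univ.erase u, influence a G u v ≤ a := by
  classical
  refine (Finset.sum_le_sum_of_subset_of_nonneg (Finset.erase_subset _ _)
    fun v _ _ => influence_nonneg ha G u v).trans ?_
  unfold influence
  rw [← Finset.sum_filter, Finset.sum_const, nsmul_eq_mul, ← G.neighborFinset_eq_filter,
    G.card_neighborFinset_eq_degree]
  rcases eq_or_ne ((G.degree u : ℕ) : ℝ) 0 with h | h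
  · rw [h]; simpa using ha
  · rw [mul_div_cancel₀ _ h]

/-- This is where the coupling strength `a * β` of the two-agent system comes from. For an isolated
agent both sides vanish, since `0 / 0 = 0`. -/
lemma sum_influence_cross (G : SimpleGraph (Agent n)) (u : Agent n) :
    ∑ v, (if u.isLeft ≠ v.isLeft then influence a G u v else 0) = a * crossFraction G u := by
  classical
  unfold influence crossFraction crossDegree
  rw [Finset.card_filter, Nat.cast_sum, ← mul_div_assoc, Finset.mul_sum, Finset.sum_div]
  refine Finset.sum_congr rfl fun v _ => ?_
  by_cases h1 : u.isLeft ≠ v.isLeft <;> by_cases h2 : G.Adj u v <;> simp [h1, h2]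

/-- In a state that depends only on the type, connections within a type cancel, so the velocity
differs from the two-agent one only by the defect `a * (crossFraction - β) * (d - c)`. -/
lemma velocity_influence_inl (G : SimpleGraph (Agent n)) (c d : ℝ) (i : Fin n) :
    velocity (influence a G) b ε (Sum.elim (fun _ => c) (fun _ => d)) (Sum.inl i) =
      a * crossFraction G (Sum.inl i) * (d - c) + b * (sgnEps ε c - c) := by
  rw [← sum_influence_cross, Finset.sum_mul, velocity, Finset.sum_erase _ (by simp)]
  simp [Fintype.sum_sum_type]

lemma velocity_influence_inr (G : SimpleGraph (Agent n)) (c d : ℝ) (i : Fin n) :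
    velocity (influence a G) b ε (Sum.elim (fun _ => c) (fun _ => d)) (Sum.inr i) =
      a * crossFraction G (Sum.inr i) * (c - d) + b * (sgnEps ε d - d) := by
  rw [← sum_influence_cross, Finset.sum_mul, velocity, Finset.sum_erase _ (by simp)]
  simp [Fintype.sum_sum_type]

lemma abs_defect_le (ha : 0 < a) {f β δ D z : ℝ} (hf : |f - β| ≤ δ) (hz : |z| ≤ D) :
    |a * (f - β) * z| ≤ a * (δ * D) := by
  rw [abs_mul, abs_mul, abs_of_pos ha, mul_assoc]
  have : 0 ≤ δ := (abs_nonneg _).trans hf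
  gcongr

/-- On every bounded time interval, the opinions on a balanced graph are close to those of the
two-agent system. -/
lemma exists_balanced_dist_le (ha : 0 < a) (hb : 0 < b) (hε : 0 < ε) {β xL xR : ℝ}
    {y : ℝ → Fin 2 → ℝ} (hy : IsTwoAgentTrajectory (a * β) b ε xL xR y) {T η : ℝ} (hT : 0 ≤ T)
    (hη : 0 < η) :
    ∃ δ, 0 < δ ∧ ∀ δ' ≤ δ, ∀ (n : ℕ), ∀ G ∈ balancedGraphs β δ' n, ∀ x,
      IsBlockTrajectory a b ε xL xR G x →
        ∀ i : Fin n, |x T (Sum.inl i) - y T 0| < η ∧ |x T (Sum.inr i) - y T 1| < η := by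
  set κ : ℝ := 2 * a + b * (ε⁻¹ + 1) with hκ
  have hκ0 : 0 ≤ κ := by positivity
  have hycont : ∀ i, ContinuousOn (fun t => y t i) (Set.Icc 0 T) := fun i t ht =>
    ((hy.deriv t ht.1 i).mono fun s hs => hs.1).continuousWithinAt
  obtain ⟨D, hD⟩ := isCompact_Icc.exists_bound_of_continuousOn ((hycont 1).sub (hycont 0))
  simp only [Real.norm_eq_abs] at hD
  -- The Grönwall bound is continuous in the defect and vanishes at zero defect; hence some positive
  -- defect `η₀` is tolerable.
  have hev : ∀ᶠ z in 𝓝[>] (0 : ℝ), gronwallBound 0 κ.toNNReal (z + 0) T < η := by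
    have hc : Continuous fun z => gronwallBound 0 (κ.toNNReal : ℝ) (z + 0) T :=
      (gronwallBound_continuous_ε _ _ _).comp (by fun_prop)
    refine (hc.tendsto 0).mono_left nhdsWithin_le_nhds |>.eventually (gt_mem_nhds ?_)
    rwa [add_zero, gronwallBound_ε0_δ0]
  obtain ⟨η₀, hη₀, hη₀0⟩ := (hev.and self_mem_nhdsWithin).exists
  have hη₀0 : 0 < η₀ := hη₀0
  -- `D` bounds the difference of the two opinions on `[0, T]`, so this choice bounds the defect by
  -- `η₀`; adding `1` avoids a zero denominator.
  refine ⟨η₀ / (a * (|D| + 1)), by positivity, fun δ hδ n G hG x hx i => ?_⟩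
  have hdef : ∀ t ∈ Set.Icc 0 T, ∀ u, ∀ z, |z| ≤ |y t 1 - y t 0| →
      |a * (crossFraction G u - β) * z| ≤ η₀ := fun t ht u z hz => by
    refine (abs_defect_le ha ((hG u).trans hδ) ((hz.trans (hD t ht)).trans
      ((le_abs_self D).trans (le_add_of_nonneg_right zero_le_one)))).trans (le_of_eq ?_)
    field_simp
  have hxd : ∀ t ∈ Set.Icc 0 T, HasDerivWithinAt x (velocity (influence a G) b ε (x t))
      (Set.Ici 0) t := fun t ht => hasDerivWithinAt_pi.2 fun i => hx.deriv t ht.1 i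
  have hyd : ∀ t ∈ Set.Icc 0 T, HasDerivWithinAt
      (fun t => (Sum.elim (fun _ => y t 0) (fun _ => y t 1) : Agent n → ℝ))
      (Sum.elim (fun _ => velocity (fun _ _ => a * β) b ε (y t) 0)
        (fun _ => velocity (fun _ _ => a * β) b ε (y t) 1)) (Set.Ici 0) t := fun t ht =>
    hasDerivWithinAt_pi.2 fun u => by
      rcases u with u | u
      · exact hy.deriv t ht.1 0
      · exact hy.deriv t ht.1 1
  have hgr := dist_le_of_approx_trajectories_ODE (a := 0) (b := T) (δ := 0) (εf := η₀) (εg := 0)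
    (v := fun _ => velocity (influence a G) b ε)
    (fun _ => lipschitzWith_velocity (influence_nonneg ha.le G) (sum_influence_le ha.le G) ha.le
      hb.le hε)
    (fun t ht => (hyd t ht).continuousWithinAt.mono fun s hs => hs.1)
    (fun t ht => (hyd t ⟨ht.1, ht.2.le⟩).mono fun s hs => ht.1.trans hs)
    (fun t ht => by
      refine (dist_pi_le_iff hη₀0.le).2 fun u => ?_
      rw [dist_comm, Real.dist_eq]
      rcases u with u | u
      · rw [velocity_influence_inl, Sum.elim_inl, velocity_two_zero]
        convert hdef t ⟨ht.1, ht.2.le⟩ (Sum.inl u) (y t 1 - y t 0) le_rfl using 2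
        ring
      · rw [velocity_influence_inr, Sum.elim_inr, velocity_two_one]
        convert hdef t ⟨ht.1, ht.2.le⟩ (Sum.inr u) (y t 0 - y t 1)
          (abs_sub_comm _ _).le using 2
        ring)
    (fun t ht => (hxd t ht).continuousWithinAt.mono fun s hs => hs.1)
    (fun t ht => (hxd t ⟨ht.1, ht.2.le⟩).mono fun s hs => ht.1.trans hs)
    (fun t ht => by rw [dist_self])
    (by
      refine (dist_pi_le_iff le_rfl).2 fun u => ?_
      have h0 := hy.initial 0
      have h1 := hy.initial 1
      simp only [Matrix.cons_val_zero, Matrix.cons_val_one] at h0 h1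
      rw [hx.initial]
      rcases u with u | u
      · simp [h0]
      · simp [h1])
    T ⟨hT, le_rfl⟩
  rw [sub_zero] at hgr
  have hlt := hgr.trans_lt hη₀
  constructor
  · have := (dist_le_pi_dist _ _ (Sum.inl i)).trans_lt hlt
    rwa [dist_comm, Real.dist_eq] at this
  · have := (dist_le_pi_dist _ _ (Sum.inr i)).trans_lt hlt
    rwa [dist_comm, Real.dist_eq] at this

/-- On a balanced graph, opinions that are close to the equilibrium stay close to it. -/
lemma abs_sub_le_of_balanced (ha : 0 < a) (hb : 0 < b) (hε : 0 < ε) {β δ xL xR eL eR σL σR r : ℝ}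
    (hL : a * β * (eR - eL) + b * (σL - eL) = 0) (hR : a * β * (eL - eR) + b * (σR - eR) = 0)
    (hσL : ∀ z, |z - eL| ≤ r → sgnEps ε z = σL) (hσR : ∀ z, |z - eR| ≤ r → sgnEps ε z = σR)
    (hr : 0 < r) (hδ : 2 * (a * (δ * |eR - eL|)) < b * r) {G : SimpleGraph (Agent n)}
    (hG : G ∈ balancedGraphs β δ n) {x : ℝ → Agent n → ℝ} (hx : IsBlockTrajectory a b ε xL xR G x)
    {T : ℝ} (hT : 0 ≤ T)
    (hclose : ∀ i, |x T (Sum.inl i) - eL| < r ∧ |x T (Sum.inr i) - eR| < r) :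
    ∀ t, T ≤ t → ∀ i, |x t (Sum.inl i) - eL| ≤ r ∧ |x t (Sum.inr i) - eR| ≤ r := by
  -- Shifting both equilibrium values by `±r` changes neither their difference nor `sgnEps`. The
  -- velocity is then the defect minus `±b * r`, so a defect below `b * r / 2` makes it point into
  -- the box.
  have hd : ∀ u z, |z| ≤ |eR - eL| → |a * (crossFraction G u - β) * z| < b * (r / 2) :=
    fun u z hz => (abs_defect_le ha (hG u) hz).trans_lt (by linarith)
  have hcL : ∀ s, |s| ≤ r → ∀ i : Fin n,
      velocity (influence a G) b ε (Sum.elim (fun _ => eL + s) (fun _ => eR + s)) (Sum.inl i) =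
        a * (crossFraction G (Sum.inl i) - β) * (eR - eL) - b * s := fun s hs i => by
    rw [velocity_influence_inl, hσL _ (by rwa [add_sub_cancel_left])]
    linear_combination hL
  have hcR : ∀ s, |s| ≤ r → ∀ i : Fin n,
      velocity (influence a G) b ε (Sum.elim (fun _ => eL + s) (fun _ => eR + s)) (Sum.inr i) =
        a * (crossFraction G (Sum.inr i) - β) * (eL - eR) - b * s := fun s hs i => by
    rw [velocity_influence_inr, hσR _ (by rwa [add_sub_cancel_left])]
    linear_combination hR
  intro t ht i
  have hup := lt_of_velocity_lt (t₀ := T) (t₁ := t) (b := b) (ε := ε) (x := x)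
    (U := fun _ => Sum.elim (fun _ => eL + r) (fun _ => eR + r)) (U' := fun _ _ => 0)
    (influence_nonneg ha.le G) (hx.hasDerivWithinAt_Icc hT)
    (fun s _ u => hasDerivWithinAt_const _ _ _)
    (fun u => by
      rcases u with u | u
      · simpa using by linarith [(abs_lt.1 (hclose u).1).2]
      · simpa using by linarith [(abs_lt.1 (hclose u).2).2])
    (fun s _ u => by
      rcases u with u | u
      · rw [hcL r (abs_of_pos hr).le]
        nlinarith [(abs_lt.1 (hd (Sum.inl u) (eR - eL) le_rfl)).2]
      · rw [hcR r (abs_of_pos hr).le]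
        nlinarith [(abs_lt.1 (hd (Sum.inr u) (eL - eR) (abs_sub_comm _ _).le)).2])
    t ⟨ht, le_rfl⟩
  have hlow := lt_of_lt_velocity (t₀ := T) (t₁ := t) (b := b) (ε := ε) (x := x)
    (U := fun _ => Sum.elim (fun _ => eL + -r) (fun _ => eR + -r)) (U' := fun _ _ => 0)
    (influence_nonneg ha.le G) hε (hx.hasDerivWithinAt_Icc hT)
    (fun s _ u => hasDerivWithinAt_const _ _ _)
    (fun u => by
      rcases u with u | u
      · simpa using by linarith [(abs_lt.1 (hclose u).1).1]
      · simpa using by linarith [(abs_lt.1 (hclose u).2).1])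
    (fun s _ u => by
      rcases u with u | u
      · rw [hcL (-r) (by rw [abs_neg, abs_of_pos hr])]
        nlinarith [(abs_lt.1 (hd (Sum.inl u) (eR - eL) le_rfl)).1]
      · rw [hcR (-r) (by rw [abs_neg, abs_of_pos hr])]
        nlinarith [(abs_lt.1 (hd (Sum.inr u) (eL - eR) (abs_sub_comm _ _).le)).1])
    t ⟨ht, le_rfl⟩
  have h1 := hup (Sum.inl i)
  have h2 := hup (Sum.inr i)
  have h3 := hlow (Sum.inl i)
  have h4 := hlow (Sum.inr i)
  simp only [Sum.elim_inl, Sum.elim_inr] at h1 h2 h3 h4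
  exact ⟨abs_le.2 ⟨by linarith, by linarith⟩, abs_le.2 ⟨by linarith, by linarith⟩⟩

/-- On balanced graphs, the opinions get and stay close to the equilibrium of the two-agent
system, within a time that does not depend on the graph. -/
theorem exists_balanced_abs_sub_le (ha : 0 < a) (hb : 0 < b) (hε : 0 < ε)
    {β xL xR eL eR σL σR r : ℝ}
    (hL : a * β * (eR - eL) + b * (σL - eL) = 0) (hR : a * β * (eL - eR) + b * (σR - eR) = 0)
    (hσL : ∀ z, |z - eL| ≤ r → sgnEps ε z = σL) (hσR : ∀ z, |z - eR| ≤ r → sgnEps ε z = σR)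
    (hr : 0 < r) (heq : IsTwoAgentEquilibrium (a * β) b ε xL xR eL eR) {ε' : ℝ} (hε' : 0 < ε') :
    ∃ δ, 0 < δ ∧ ∃ T, 0 < T ∧ ∀ (n : ℕ), ∀ G ∈ balancedGraphs β δ n, ∀ x,
      IsBlockTrajectory a b ε xL xR G x → ∀ t, T ≤ t → ∀ i : Fin n,
        |x t (Sum.inl i) - eL| ≤ ε' ∧ |x t (Sum.inr i) - eR| ≤ ε' := by
  obtain ⟨⟨y, hy⟩, hlim⟩ := heq
  obtain ⟨h0, h1⟩ := hlim y hy
  set ρ := min r ε' with hρ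
  have hρ0 : 0 < ρ := lt_min hr hε'
  obtain ⟨T, ⟨hT0, hT1⟩, hT⟩ := (((h0.eventually (Metric.ball_mem_nhds _ (half_pos hρ0))).and
    (h1.eventually (Metric.ball_mem_nhds _ (half_pos hρ0)))).and (eventually_gt_atTop 0)).exists
  rw [Real.dist_eq] at hT0 hT1
  obtain ⟨δ₀, hδ₀, hδ⟩ := exists_balanced_dist_le ha hb hε hy hT.le (half_pos hρ0)
  -- `δ₀` gives closeness to the two-agent system at time `T`; the second entry bounds the defect at
  -- the equilibrium by `b * ρ / 4`, as the trapping box of radius `ρ` requires.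
  set δ := min δ₀ (b * ρ / (4 * a * (|eR - eL| + 1))) with hδdef
  have hδ0 : 0 < δ := by positivity
  refine ⟨δ, hδ0, T, hT, fun n G hG x hx t ht i => ?_⟩
  have hc := hδ δ (min_le_left _ _) n G hG x hx
  have := abs_sub_le_of_balanced ha hb hε hL hR
    (fun z hz => hσL z (hz.trans (min_le_left _ _)))
    (fun z hz => hσR z (hz.trans (min_le_left _ _))) hρ0 (by
      have h2 : δ * |eR - eL| ≤ b * ρ / (4 * a * (|eR - eL| + 1)) * (|eR - eL| + 1) := by
        gcongr
        · exact min_le_right _ _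
        · linarith
      have h3 : a * (b * ρ / (4 * a * (|eR - eL| + 1)) * (|eR - eL| + 1)) = b * ρ / 4 := by
        field_simp
      have h4 := mul_le_mul_of_nonneg_left h2 ha.le
      have h5 : 0 < b * ρ := by positivity
      linarith) hG hx hT.le (fun j => by
      constructor
      · have := abs_sub_le (x T (Sum.inl j)) (y T 0) eL
        linarith [(hc j).1]
      · have := abs_sub_le (x T (Sum.inr j)) (y T 1) eR
        linarith [(hc j).2]) t ht i
  exact ⟨this.1.trans (min_le_right _ _), this.2.trans (min_le_right _ _)⟩

end Block

/-! ### Concentration of sums of independent coins -/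

section Coins

variable {ι : Type*} {P : ι → unitInterval}

open Classical in
/-- The indicator of the event that the coin `e` comes up `True`. -/
noncomputable def coin (e : ι) (ω : ι → Prop) : ℝ := if ω e then 1 else 0

lemma measurable_coin (e : ι) : Measurable (coin e) := by
  classical
  have h : Measurable fun a : Prop => (if a then 1 else 0 : ℝ) := .of_discrete
  exact h.comp (measurable_pi_apply e)

lemma mgf_coin [Fintype ι] (e : ι) (t : ℝ) :
    mgf (coin e) (Measure.pi fun e => bernoulliMeasure True False (P e)) t =
      P e * Real.exp t + (1 - P e) := by
  classical
  have h := (measurePreserving_eval (fun e => bernoulliMeasure True False (P e)) e)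
  have h2 := integral_map (μ := Measure.pi fun e => bernoulliMeasure True False (P e))
    h.measurable.aemeasurable
    (f := fun a : Prop => Real.exp (t * (if a then 1 else 0)))
    (Measurable.of_discrete.aestronglyMeasurable)
  rw [h.map_eq, integral_bernoulliMeasure] at h2
  unfold mgf coin
  simp only [Function.eval] at h2
  rw [← h2]
  simp

/-- Injectivity makes the coins independent, so the generating function is a product, and `1 + z ≤
exp z` in each factor gives the Poisson bound with the same mean. -/
lemma mgf_sum_coin_le [Fintype ι] {κ : Type*} (f : κ → ι) (hf : Function.Injective f) (s : Finset κ)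
    {p : ℝ} (hp : ∀ k ∈ s, (P (f k) : ℝ) = p) (t : ℝ) :
    mgf (∑ k ∈ s, coin (f k)) (Measure.pi fun e => bernoulliMeasure True False (P e)) t ≤
      Real.exp (s.card * p * (Real.exp t - 1)) := by
  classical
  have hind : iIndepFun (fun e (ω : ι → Prop) => coin e ω)
      (Measure.pi fun e => bernoulliMeasure True False (P e)) :=
    iIndepFun_pi (X := fun _ (a : Prop) => (if a then 1 else 0 : ℝ))
      fun _ => Measurable.of_discrete.aemeasurable
  have hind' := hind.precomp hf
  rw [iIndepFun.mgf_sum (X := fun k => coin (f k)) hind' (fun k => measurable_coin _) s]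
  calc _ ≤ ∏ k ∈ s, Real.exp (p * (Real.exp t - 1)) := by
        refine Finset.prod_le_prod (fun k _ => mgf_nonneg) fun k hk => ?_
        rw [mgf_coin, hp k hk]
        have := Real.add_one_le_exp (p * (Real.exp t - 1))
        linarith
    _ = _ := by
        rw [Finset.prod_const, ← Real.exp_nat_mul]
        congr 1; ring

lemma integrable_exp_mul_sum_coin [Fintype ι] {κ : Type*} (f : κ → ι) (s : Finset κ) (t : ℝ) :
    Integrable (fun ω => Real.exp (t * (∑ k ∈ s, coin (f k)) ω))
      (Measure.pi fun e => bernoulliMeasure True False (P e)) := by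
  have hm : Measurable (∑ k ∈ s, coin (f k)) := by
    rw [Finset.sum_fn]
    exact Finset.measurable_sum _ fun k _ => measurable_coin (f k)
  refine Integrable.of_bound (C := Real.exp (|t| * s.card))
    (hm.const_mul t).exp.aestronglyMeasurable (ae_of_all _ fun ω => ?_)
  rw [Real.norm_eq_abs, Real.abs_exp, Real.exp_le_exp, Finset.sum_apply]
  have h0 : ∀ k ∈ s, 0 ≤ coin (f k) ω := fun k _ => by unfold coin; split_ifs <;> norm_num
  have h1 : ∑ k ∈ s, coin (f k) ω ≤ s.card := by
    calc _ ≤ ∑ k ∈ s, (1 : ℝ) := Finset.sum_le_sum fun k _ => by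
          unfold coin; split_ifs <;> norm_num
      _ = _ := by simp
  have h2 := Finset.sum_nonneg h0
  calc t * ∑ k ∈ s, coin (f k) ω ≤ |t| * ∑ k ∈ s, coin (f k) ω :=
        mul_le_mul_of_nonneg_right (le_abs_self t) h2
    _ ≤ _ := mul_le_mul_of_nonneg_left h1 (abs_nonneg t)

/-- Chernoff bound for the relative deviation of a sum of independent coins from its mean. -/
theorem measureReal_sum_coin_le [Fintype ι] {κ : Type*} (f : κ → ι) (hf : Function.Injective f)
    (s : Finset κ) {p η : ℝ} (hp0 : 0 ≤ p) (hp : ∀ k ∈ s, (P (f k) : ℝ) = p) (hη : 0 < η) (hη1 : η ≤ 1) :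
    (Measure.pi fun e => (bernoulliMeasure True False (P e) : Measure Prop)).real
      {ω | η * (s.card * p) ≤ |∑ k ∈ s, coin (f k) ω - s.card * p|} ≤
      2 * Real.exp (-(s.card * p * (η ^ 2 / 4))) := by
  set μ := Measure.pi fun e => (bernoulliMeasure True False (P e) : Measure Prop)
  set Y := ∑ k ∈ s, coin (f k) with hY
  set m := s.card * p with hm
  have hm0 : 0 ≤ m := by positivity
  have hYω : ∀ ω, ∑ k ∈ s, coin (f k) ω = Y ω := fun ω => by rw [hY, Finset.sum_apply]
  simp only [hYω]
  have hup : μ.real {ω | (1 + η) * m ≤ Y ω} ≤ Real.exp (-(m * (η ^ 2 / 4))) := by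
    -- With `exp t - 1 ≤ t + t ^ 2` the exponent is at most `m * (t ^ 2 - t * η)`, which is minimal
    -- at `t = η / 2`. The lower tail uses `-(η / 2)` in the same way.
    refine (measure_ge_le_exp_mul_mgf (t := η / 2) _ (by positivity)
      (integrable_exp_mul_sum_coin f s _)).trans ?_
    refine (mul_le_mul_of_nonneg_left (mgf_sum_coin_le f hf s hp _) (Real.exp_pos _).le).trans ?_
    rw [← Real.exp_add, Real.exp_le_exp]
    have h := (abs_le.1 (Real.abs_exp_sub_one_sub_id_le (x := η / 2)
      (by rw [abs_of_pos (by positivity)]; linarith))).2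
    have := mul_le_mul_of_nonneg_left h hm0
    rw [← hm]
    nlinarith
  have hlow : μ.real {ω | Y ω ≤ (1 - η) * m} ≤ Real.exp (-(m * (η ^ 2 / 4))) := by
    refine (measure_le_le_exp_mul_mgf (t := -(η / 2)) _ (by linarith)
      (integrable_exp_mul_sum_coin f s _)).trans ?_
    refine (mul_le_mul_of_nonneg_left (mgf_sum_coin_le f hf s hp _) (Real.exp_pos _).le).trans ?_
    rw [← Real.exp_add, Real.exp_le_exp]
    have h := (abs_le.1 (Real.abs_exp_sub_one_sub_id_le (x := -(η / 2))
      (by rw [abs_neg, abs_of_pos (by positivity)]; linarith))).2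
    have := mul_le_mul_of_nonneg_left h hm0
    rw [← hm]
    nlinarith
  calc _ ≤ μ.real ({ω | (1 + η) * m ≤ Y ω} ∪ {ω | Y ω ≤ (1 - η) * m}) := by
        refine measureReal_mono (fun ω hω => ?_)
        simp only [Set.mem_ofPred_eq, Set.mem_union] at hω ⊢
        rcases le_abs.1 hω with h | h
        · left; linarith
        · right; linarith
    _ ≤ _ := measureReal_union_le _ _
    _ ≤ _ := by linarith

end Coins

/-! ### The stochastic block model is balanced with high probability -/

/-- Makes every function of the random graph measurable, including opinions given by an arbitrary
choice of a trajectory for each graph. -/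
instance {V : Type*} [Finite V] : DiscreteMeasurableSpace (SimpleGraph V) where
  forall_measurableSet _ :=
    (SimpleGraph.measurableEmbedding_edgeSet (V := V)).measurableSet_image.1 .of_discrete

lemma isProbabilityMeasure_blockModel (n : ℕ) (p q : unitInterval) :
    IsProbabilityMeasure (blockModel n p q) :=
  Measure.isProbabilityMeasure_map Measurable.of_discrete.aemeasurable

section BlockModel

variable {n : ℕ}

lemma connectionProb_mk (p q : unitInterval) (u v : Agent n) :
    connectionProb p q s(u, v) = if u.isLeft = v.isLeft then p else q := rfl

open Classical in
/-- The other agents of the same type. -/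
noncomputable def sameType (u : Agent n) : Finset (Agent n) :=
  Finset.univ.filter fun v => u ≠ v ∧ u.isLeft = v.isLeft

open Classical in
/-- The agents of the other type. -/
noncomputable def otherType (u : Agent n) : Finset (Agent n) :=
  Finset.univ.filter fun v => u.isLeft ≠ v.isLeft

lemma card_otherType (u : Agent n) : (otherType u).card = n := by
  classical
  unfold otherType
  rw [Finset.card_filter, Fintype.sum_sum_type]
  rcases u with u | u <;> simp

lemma card_sameType (u : Agent n) : (sameType u).card = n - 1 := by
  classical
  unfold sameType
  rw [Finset.card_filter, Fintype.sum_sum_type]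
  have h : ∀ u : Fin n, ∑ v, (if u = v then 0 else 1) = n - 1 := fun u => by
    rw [← Finset.sum_erase_add _ _ (Finset.mem_univ u), if_pos rfl, add_zero,
      Finset.sum_congr rfl fun v hv => if_neg (Finset.ne_of_mem_erase hv).symm]
    simp
  rcases u with u | u <;> simp [h]

/-- For fixed `u` the pairs `s(u, v)` are distinct, so this is a sum of independent coins. Different
agents share coins, but a union bound over agents needs no independence. -/
lemma crossDegree_fromEdgeSet (ω : Sym2 (Agent n) → Prop) (u : Agent n) :
    (crossDegree (SimpleGraph.fromEdgeSet {e | ω e}) u : ℝ) =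
      ∑ v ∈ otherType u, coin s(u, v) ω := by
  classical
  unfold crossDegree otherType coin
  rw [Finset.sum_filter, Finset.card_filter, Nat.cast_sum]
  refine Finset.sum_congr rfl fun v _ => ?_
  have h : u.isLeft ≠ v.isLeft → u ≠ v := fun h h' => h (by rw [h'])
  by_cases h1 : u.isLeft ≠ v.isLeft
  · by_cases h2 : ω s(u, v) <;> simp [h1, h2, h h1]
  · simp [h1]

open Classical in
lemma degree_fromEdgeSet (ω : Sym2 (Agent n) → Prop) (u : Agent n) :
    ((SimpleGraph.fromEdgeSet {e | ω e}).degree u : ℝ) =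
      ∑ v ∈ sameType u, coin s(u, v) ω + ∑ v ∈ otherType u, coin s(u, v) ω := by
  unfold sameType otherType coin
  rw [← SimpleGraph.card_neighborFinset_eq_degree, SimpleGraph.neighborFinset_eq_filter,
    Finset.card_filter, Nat.cast_sum, Finset.sum_filter, Finset.sum_filter,
    ← Finset.sum_add_distrib]
  refine Finset.sum_congr rfl fun v _ => ?_
  have h : u.isLeft ≠ v.isLeft → u ≠ v := fun h h' => h (by rw [h'])
  by_cases h1 : u.isLeft = v.isLeft
  · by_cases h2 : ω s(u, v) <;> by_cases h3 : u = v <;> simp [h1, h2, h3]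
  · by_cases h2 : ω s(u, v) <;> simp [h1, h2, h h1]

lemma crossFraction_fromEdgeSet (ω : Sym2 (Agent n) → Prop) (u : Agent n) :
    crossFraction (SimpleGraph.fromEdgeSet {e | ω e}) u = (∑ v ∈ otherType u, coin s(u, v) ω) /
      (∑ v ∈ sameType u, coin s(u, v) ω + ∑ v ∈ otherType u, coin s(u, v) ω) := by
  unfold crossFraction
  rw [crossDegree_fromEdgeSet]
  congr 1
  convert degree_fromEdgeSet ω u

/-- Counts that are close to their expectations have a ratio close to the ratio of the
expectations. -/
lemma abs_div_add_sub_div_add_le {A B α γ η : ℝ} (hα : 0 < α) (hγ : 0 < γ)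
    (hη1 : η ≤ 1 / 2) (hA : |A - α| ≤ η * α) (hB : |B - γ| ≤ η * γ) :
    |B / (A + B) - γ / (γ + α)| ≤ 2 * η := by
  rw [abs_le] at hA hB
  have hη : 0 ≤ η := by
    by_contra! h
    nlinarith
  have hAB : (α + γ) / 2 ≤ A + B := by nlinarith
  have hABpos : 0 < A + B := by linarith
  rw [div_sub_div _ _ hABpos.ne' (by positivity), abs_div,
    abs_of_pos (show 0 < (A + B) * (γ + α) by positivity), div_le_iff₀ (by positivity)]
  -- The left side is the absolute value of `α * (B - γ) - γ * (A - α)`.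
  have h1 : |B * (γ + α) - (A + B) * γ| ≤ 2 * η * (α * γ) := by
    rw [abs_le]; constructor <;> nlinarith
  refine h1.trans ?_
  have h2 : α * γ ≤ (A + B) * (γ + α) := by
    nlinarith [mul_le_mul_of_nonneg_right hAB (show 0 ≤ γ + α by linarith), sq_nonneg (α - γ)]
  nlinarith

/-- Each count involves at least `n / 2` coins, so the factor `16 / η ^ 2` makes the Chernoff
exponent at least `2 log n` and each failure probability at most `2 / n ^ 2`. Two counts for each of
`2n` agents give `8 / n`. Replacing the mean `(n - 1) p` by `n p` costs `p ≤ η n p`, hence relative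
errors of at most `2 η` and an error of at most `4 η` in the ratio. -/
lemma blockModel_balanced_compl_le {p q : unitInterval} {β δ η : ℝ} (hn : 2 ≤ n) (hη : 0 < η)
    (hη1 : η ≤ 1 / 4) (hηn : 1 ≤ η * n) (hηδ : 4 * η + |(q : ℝ) / (q + p) - β| ≤ δ)
    (hp : 16 / η ^ 2 * (Real.log n / n) < p) (hq : 16 / η ^ 2 * (Real.log n / n) < q) :
    (blockModel n p q).real (balancedGraphs β δ n)ᶜ ≤ 8 / n := by
  have hn0 : (0 : ℝ) < n := by positivity
  have hn2 : (2 : ℝ) ≤ n := by exact_mod_cast hn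
  have hlog : 0 < Real.log n := Real.log_pos (by linarith)
  have hp0 : 0 < (p : ℝ) := lt_trans (by positivity) hp
  have hq0 : 0 < (q : ℝ) := lt_trans (by positivity) hq
  have hn1 : ((n - 1 : ℕ) : ℝ) = n - 1 := by rw [Nat.cast_sub (by omega), Nat.cast_one]
  set μ := Measure.pi fun e : Sym2 (Agent n) =>
    (bernoulliMeasure True False (connectionProb p q e) : Measure Prop) with hμ
  have hinj : ∀ u : Agent n, Function.Injective fun v => s(u, v) := fun u v v' h => Sym2.congr_right.1 h
  set badSame : Agent n → Set (Sym2 (Agent n) → Prop) := fun u =>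
    {ω | η * ((sameType u).card * (p : ℝ)) ≤
      |∑ v ∈ sameType u, coin s(u, v) ω - (sameType u).card * (p : ℝ)|} with hbS
  set badOther : Agent n → Set (Sym2 (Agent n) → Prop) := fun u =>
    {ω | η * ((otherType u).card * (q : ℝ)) ≤
      |∑ v ∈ otherType u, coin s(u, v) ω - (otherType u).card * (q : ℝ)|} with hbO
  have hexp : ∀ m z : ℝ, (n : ℝ) / 2 ≤ m → 16 / η ^ 2 * (Real.log n / n) < z →
      2 * Real.exp (-(m * z * (η ^ 2 / 4))) ≤ 2 / n ^ 2 := by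
    intro m z hm hz
    have h1 : 2 * Real.log n ≤ m * z * (η ^ 2 / 4) := by
      have h2 : 16 / η ^ 2 * (Real.log n / n) * (n / 2 * (η ^ 2 / 4)) = 2 * Real.log n := by
        field_simp; norm_num
      have h0 : 0 ≤ z := le_trans (by positivity) hz.le
      calc 2 * Real.log n = n / 2 * (16 / η ^ 2 * (Real.log n / n)) * (η ^ 2 / 4) := by
            rw [← h2]; ring
        _ ≤ m * z * (η ^ 2 / 4) := by
            have : 0 ≤ m := le_trans (by positivity) hm
            gcongr
    calc 2 * Real.exp (-(m * z * (η ^ 2 / 4))) ≤ 2 * Real.exp (-(2 * Real.log n)) := by gcongr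
      _ = 2 / n ^ 2 := by
        rw [Real.exp_neg, two_mul (Real.log _), Real.exp_add, Real.exp_log hn0, sq, div_eq_mul_inv]
  have hSame : ∀ u, μ.real (badSame u) ≤ 2 / n ^ 2 := fun u => by
    refine (measureReal_sum_coin_le (fun v => s(u, v)) (hinj u) (sameType u) hp0.le
      (fun v hv => ?_) hη (by linarith)).trans (hexp _ _ ?_ hp)
    · rw [connectionProb_mk, if_pos]
      simp only [sameType, Finset.mem_filter] at hv
      exact hv.2.2
    · rw [card_sameType, hn1]; linarith
  have hOther : ∀ u, μ.real (badOther u) ≤ 2 / n ^ 2 := fun u => by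
    refine (measureReal_sum_coin_le (fun v => s(u, v)) (hinj u) (otherType u) hq0.le
      (fun v hv => ?_) hη (by linarith)).trans (hexp _ _ ?_ hq)
    · rw [connectionProb_mk, if_neg]
      simp only [otherType, Finset.mem_filter] at hv
      exact hv.2
    · rw [card_otherType]; linarith
  have hsub : (fun ω : Sym2 (Agent n) → Prop => SimpleGraph.fromEdgeSet {e | ω e}) ⁻¹'
      (balancedGraphs β δ n)ᶜ ⊆ ⋃ u ∈ Finset.univ, (badSame u ∪ badOther u) := by
    intro ω hω
    by_contra hcon
    simp only [Finset.mem_univ, Set.iUnion_true, Set.mem_iUnion, Set.mem_union, not_exists,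
      not_or, hbS, hbO, Set.mem_ofPred_eq, not_le, card_sameType, card_otherType, hn1] at hcon
    refine hω fun u => ?_
    obtain ⟨h1, h2⟩ := hcon u
    rw [crossFraction_fromEdgeSet]
    have h3 : |∑ v ∈ sameType u, coin s(u, v) ω - n * (p : ℝ)| ≤ 2 * η * (n * p) := by
      have h4 := abs_sub_le (∑ v ∈ sameType u, coin s(u, v) ω) ((n - 1) * (p : ℝ)) (n * p)
      have h5 : |((n : ℝ) - 1) * p - n * p| = p := by
        rw [show ((n : ℝ) - 1) * p - n * p = -p by ring, abs_neg, abs_of_pos hp0]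
      nlinarith
    have h4 : |∑ v ∈ otherType u, coin s(u, v) ω - n * (q : ℝ)| ≤ 2 * η * (n * q) := by
      have : 0 < η * (n * (q : ℝ)) := by positivity
      linarith
    have h5 := abs_div_add_sub_div_add_le (by positivity) (by positivity) (by linarith) h3 h4
    rw [← mul_add, mul_div_mul_left _ _ hn0.ne'] at h5
    have h6 := abs_sub_le ((∑ v ∈ otherType u, coin s(u, v) ω) /
      (∑ v ∈ sameType u, coin s(u, v) ω + ∑ v ∈ otherType u, coin s(u, v) ω))
      ((q : ℝ) / (q + p)) β
    linarith
  unfold blockModel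
  rw [map_measureReal_apply .of_discrete .of_discrete]
  calc _ ≤ μ.real (⋃ u ∈ Finset.univ, (badSame u ∪ badOther u)) := measureReal_mono hsub (measure_ne_top _ _)
    _ ≤ ∑ u, μ.real (badSame u ∪ badOther u) := measureReal_biUnion_finset_le _ _
    _ ≤ ∑ u : Agent n, (4 / (n : ℝ) ^ 2) := Finset.sum_le_sum fun u _ =>
        (measureReal_union_le _ _).trans (by
          have := hSame u
          have := hOther u
          have : (4 : ℝ) / n ^ 2 = 2 / n ^ 2 + 2 / n ^ 2 := by ring
          linarith)
    _ = 8 / n := by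
        rw [Finset.sum_const, Finset.card_univ, Fintype.card_sum, Fintype.card_fin,
          nsmul_eq_mul, Nat.cast_add]
        field_simp
        norm_num

/-- The graph is balanced with high probability. -/
theorem tendsto_blockModel_balanced {p q : ℕ → unitInterval} {β δ : ℝ}
    (hp : IsLittleOmega (fun n => (p n : ℝ)) (fun n => Real.log n / n))
    (hq : IsLittleOmega (fun n => (q n : ℝ)) (fun n => Real.log n / n))
    (hlim : Tendsto (fun n => (q n : ℝ) / ((q n : ℝ) + (p n : ℝ))) atTop (𝓝 β)) (hδ : 0 < δ) :
    Tendsto (fun n => blockModel n (p n) (q n) (balancedGraphs β δ n)) atTop (𝓝 1) := by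
  have hprob := fun n => isProbabilityMeasure_blockModel n (p n) (q n)
  -- Half of `δ` is spent on the fluctuations `4 * η`, the other half on the distance of `q / (q +
  -- p)` from `β`.
  set η := min (1 / 4) (δ / 8) with hη
  have hη0 : 0 < η := by positivity
  have hηδ : η ≤ δ / 8 := min_le_right _ _
  obtain ⟨n₁, _, h1⟩ := hp (16 / η ^ 2) (by positivity)
  obtain ⟨n₂, _, h2⟩ := hq (16 / η ^ 2) (by positivity)
  have hbound : ∀ᶠ n in atTop,
      (blockModel n (p n) (q n)).real (balancedGraphs β δ n)ᶜ ≤ 8 / (n : ℝ) := by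
    have hcast : Tendsto (fun n : ℕ => η * (n : ℝ)) atTop atTop :=
      tendsto_natCast_atTop_atTop.const_mul_atTop hη0
    filter_upwards [eventually_ge_atTop n₁, eventually_ge_atTop n₂, eventually_ge_atTop 2,
      hcast.eventually_ge_atTop 1, hlim.eventually (Metric.ball_mem_nhds _ (half_pos hδ))]
      with n hn1 hn2 hn hηn hd
    have hd' : |(q n : ℝ) / (q n + p n) - β| < δ / 2 := hd
    exact blockModel_balanced_compl_le hn hη0 (min_le_left _ _) hηn (by linarith)
      (h1 n hn1) (h2 n hn2)
  have hzero : Tendsto (fun n => (blockModel n (p n) (q n)).real (balancedGraphs β δ n)ᶜ)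
      atTop (𝓝 0) :=
    squeeze_zero' (.of_forall fun n => measureReal_nonneg) hbound
      (tendsto_const_div_atTop_nhds_zero_nat 8)
  have hone : Tendsto (fun n => (blockModel n (p n) (q n)).real (balancedGraphs β δ n))
      atTop (𝓝 1) := by
    have := hzero.const_sub 1
    rw [sub_zero] at this
    refine this.congr fun n => ?_
    rw [probReal_compl_eq_one_sub .of_discrete, sub_sub_cancel]
  rw [← ENNReal.ofReal_one]
  refine (ENNReal.tendsto_ofReal hone).congr fun n => ?_
  exact ofReal_measureReal

end BlockModel

/-- If a random variable on a discrete space is within `r` of `e` on the event `C`, so is its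
conditional expectation. -/
lemma abs_condExpectation_sub_le {Ω : Type*} [MeasurableSpace Ω] [DiscreteMeasurableSpace Ω]
    {μ : Measure Ω} [IsFiniteMeasure μ] {X : Ω → ℝ} {C : Set Ω} (hC : μ C ≠ 0) {e r : ℝ}
    (h : ∀ ω ∈ C, |X ω - e| ≤ r) : |condExpectation μ X C - e| ≤ r := by
  have hprob : IsProbabilityMeasure (cond μ C) := cond_isProbabilityMeasure hC
  have hae : ∀ᵐ ω ∂(cond μ C), |X ω - e| ≤ r := by
    filter_upwards [ae_cond_mem (μ := μ) (s := C) .of_discrete] with ω hω using h ω hω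
  have hint : Integrable (fun ω => X ω - e) (cond μ C) :=
    Integrable.of_bound Measurable.of_discrete.aestronglyMeasurable r hae
  have h1 : condExpectation μ X C - e = ∫ ω, (X ω - e) ∂(cond μ C) := by
    have hX : Integrable X (cond μ C) := by
      exact (hint.add (integrable_const e)).congr (ae_of_all _ fun ω => sub_add_cancel _ _)
    rw [integral_sub hX (integrable_const e), integral_const, probReal_univ, one_smul]
    rfl
  rw [h1, ← Real.norm_eq_abs]
  refine (norm_integral_le_of_norm_le_const hae).trans ?_
  rw [probReal_univ, mul_one]

end OpinionDynamics

open OpinionDynamics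
theorem theorem2 (a b β xL xR : ℝ) (ha : 0 < a) (hb : 0 < b) (hβ : 0 < β)
    (hcond : ConditionPD (a * β) b xL xR ∨ ConditionCO (a * β) b xL xR) :
    ∃ eL eR ε₀ : ℝ, 0 < ε₀ ∧ ∀ ε : ℝ, 0 < ε → ε < ε₀ →
      IsTwoAgentEquilibrium (a * β) b ε xL xR eL eR ∧
      (∀ (n : ℕ) (G : SimpleGraph (Agent n)), ∃ x, IsBlockTrajectory a b ε xL xR G x) ∧
      ∀ p q : ℕ → unitInterval,
        IsLittleOmega (fun n => (p n : ℝ)) (fun n => Real.log n / n) →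
        IsLittleOmega (fun n => (q n : ℝ)) (fun n => Real.log n / n) →
        Tendsto (fun n => (q n : ℝ) / ((q n : ℝ) + (p n : ℝ))) atTop (𝓝 β) →
        ∀ ε' : ℝ, 0 < ε' →
          ∃ δ : ℝ, 0 < δ ∧ ∃ N : ℕ, 0 < N ∧ ∃ T : ℝ, 0 < T ∧
          ∃ C : ℝ → (n : ℕ) → Set (SimpleGraph (Agent n)),
            Tendsto (fun n => blockModel n (p n) (q n) (C δ n)) atTop (𝓝 1) ∧
            ∀ n : ℕ, N ≤ n →
              0 < blockModel n (p n) (q n) (C δ n) ∧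
              ∀ x : SimpleGraph (Agent n) → ℝ → Agent n → ℝ,
                (∀ G, IsBlockTrajectory a b ε xL xR G (x G)) →
                ∀ t : ℝ, T ≤ t → ∀ i j : Fin n,
                  |condExpectation (blockModel n (p n) (q n))
                      (fun G => x G t (Sum.inl i)) (C δ n) - eL| ≤ ε' ∧
                  |condExpectation (blockModel n (p n) (q n))
                      (fun G => x G t (Sum.inr j)) (C δ n) - eR| ≤ ε' := by
  have hrob : HasRobustEquilibrium (a * β) b xL xR :=
    hcond.elim (hasRobustEquilibrium_of_conditionPD (mul_pos ha hβ) hb)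
      (hasRobustEquilibrium_of_conditionCO (mul_pos ha hβ) hb)
  obtain ⟨eL, eR, σL, σR, ε₀, r, hε₀, hr, hL, hR, h⟩ := hrob
  refine ⟨eL, eR, ε₀, hε₀, fun ε hε hεlt => ?_⟩
  obtain ⟨heq, hσL, hσR⟩ := h ε hε hεlt
  refine ⟨heq, fun n G => exists_isTrajectory (influence_nonneg ha.le G) hb hε _,
    fun p q hp hq hlim ε' hε' => ?_⟩
  obtain ⟨δ, hδ, T, hT, hconv⟩ :=
    exists_balanced_abs_sub_le ha hb hε hL hR hσL hσR hr heq hε'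
  have hC := tendsto_blockModel_balanced hp hq hlim hδ
  obtain ⟨N, hN⟩ := eventually_atTop.1 (hC.eventually (lt_mem_nhds zero_lt_one))
  -- The index `N` beyond which the event has positive probability may be zero, hence `N + 1`.
  refine ⟨δ, hδ, N + 1, N.succ_pos, T, hT, balancedGraphs β, hC, fun n hn => ?_⟩
  have hpos := hN n ((Nat.le_succ N).trans hn)
  have hprob := isProbabilityMeasure_blockModel n (p n) (q n)
  refine ⟨hpos, fun x hx t ht i j => ⟨?_, ?_⟩⟩
  · exact abs_condExpectation_sub_le hpos.ne' fun G hG =>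
      (hconv n G hG (x G) (hx G) t ht i).1
  · exact abs_condExpectation_sub_le hpos.ne' fun G hG =>
      (hconv n G hG (x G) (hx G) t ht j).2
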